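/- Let $k$ be an algebraically closed field. A \emph{nodal curve} is a reduced projective $k$-scheme $X$ of pure dimension $1$ whose only singularities are nodes (ordinary double points). Let $\nu:X^\nu\to X$ be its normalization, $X_{\rm sing}$ its set of nodes and $C_1,\dots,C_\gamma$ the connected components of $X^\nu$. The \emph{dual graph} $\Gamma_X$ has vertices $C_1,\dots,C_\gamma$ and edge set $X_{\rm sing}$; the two half-edges of the edge $e$ are the two points of $\nu^{-1}(e)$, each attached to the component containing it. A node is \emph{separating} if removing it from $X$ increases the number of connected components; an edge of a graph is separating if removing it increases the number of connected components of the graph. A \emph{cycle} is a connected graph with $h$ edges and $h$ vertices, each of valency $2$, for some $h\ge 1$. For a set $S$ of edges of a graph $\Gamma$, let $\Gamma\smallsetminus S$ be $\Gamma$ with the edges of $S$ removed, and $\Gamma(S)$ the graph obtained from $\Gamma$ by contracting all edges not in $S$. A set $S\subseteq X_{\rm sing}$ is a \emph{C1-set} of $X$ if $\Gamma_X\smallsetminus S$ has no separating edge and $\Gamma_X(S)$ is a cycle; ${\rm Set}^1X$ is the set of C1-sets. An orientation of $\Gamma_X$ is an ordering $(s_e,t_e)$ of the two points of $\nu^{-1}(e)$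 for each node $e$. It gives $\partial: C_1(\Gamma_X,\mathbb Z)\to C_0(\Gamma_X,\mathbb Z)$, sending $e$ to (component of $t_e$) $-$ (component of $s_e$), the group $H_1(\Gamma_X,\mathbb Z)=\ker\partial$, and the homomorphism $$\eta_X:H_1(\Gamma_X,\mathbb Z)\to \operatorname{Div}^{\underline 0}X^\nu,\qquad \sum_e n_e e\mapsto\sum_e n_e(t_e-s_e),$$ where $\operatorname{Div}^{\underline 0}X^\nu$ is the group of divisors of degree $0$ on every $C_i$. The group $K_\gamma=\{\pm1\}^\gamma$ acts on $\operatorname{Div}^{\underline 0}X^\nu=\prod_i\operatorname{Div}^0C_i$ componentwise by signs. Let $X,X'$ be connected nodal curves over $k$, both without separating nodes, with normalizations $\nu:X^\nu\to X$, $\nu':X'^\nu\to X'$. $X$ and $X'$ are \emph{C1-equivalent} if there are an isomorphism $\phi:X^\nu\to X'^\nu$ over $k$ and a bijection ${\rm Set}^1X\to{\rm Set}^1X'$, $S\mapsto S'$, such that $\phi(\nu^{-1}(S))=\nu'^{-1}(S')$ for all $S\in{\rm Set}^1X$. $X$ and $X'$ are \emph{T-equivalent} if there are an isomorphism $\phi:X^\nu\to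 X'^\nu$ over $k$ and a cyclic bijection $\epsilon:X_{\rm sing}\to X'_{\rm sing}$ (a bijection between the edges of $\Gamma_X$ and those of $\Gamma_{X'}$ under which the edge sets of the cycles contained in $\Gamma_X$ correspond to those of the cycles contained in $\Gamma_{X'}$) such that for every orientation of $\Gamma_X$ there are an orientation of $\Gamma_{X'}$ and an $\alpha\in K_\gamma$ for which the isomorphism $C_1(\Gamma_X,\mathbb Z)\to C_1(\Gamma_{X'},\mathbb Z)$ induced by $\epsilon$ restricts to an isomorphism $\epsilon_H:H_1(\Gamma_X,\mathbb Z)\to H_1(\Gamma_{X'},\mathbb Z)$ and $$\phi_D\circ\alpha\circ\eta_X=\eta_{X'}\circ\epsilon_H ,$$ where $\phi_D:\operatorname{Div}^{\underline 0}X^\nu\to\operatorname{Div}^{\underline 0}X'^\nu$ is induced by $\phi$. \textbf{Proposition.} $X$ and $X'$ are T-equivalent if and only if they are C1-equivalent. -/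

import Mathlib

open AlgebraicGeometry
open CategoryTheory hiding ConnectedComponents

universe u

noncomputable section

/-! ## Graphs (loops and multiple edges allowed), given by their half-edges -/

/-- A graph with vertices `V`, edges `E` and half-edges `H`.  Every edge consists of exactly two
half-edges, and every half-edge is attached to one vertex.  Loops and multiple edges are allowed. -/
structure HGraph where
  V : Type u
  E : Type u
  H : Type u
  edge : H → E
  vert : H → V
  two_halves : ∀ e : E, ∃ h₁ h₂ : H, h₁ ≠ h₂ ∧ ∀ h, edge h = e ↔ h = h₁ ∨ h = h₂

namespace HGraph

variable (Γ : HGraph.{u})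

/-- Two vertices are adjacent if they are the ends of some edge. -/
def Adj (v w : Γ.V) : Prop :=
  ∃ h₁ h₂ : Γ.H, h₁ ≠ h₂ ∧ Γ.edge h₁ = Γ.edge h₂ ∧ Γ.vert h₁ = v ∧ Γ.vert h₂ = w

/-- The set of connected components (the quotient of `V` by the equivalence relation generated by
adjacency). -/
def Components : Type u := Quot Γ.Adj

/-- A graph is connected if it has exactly one connected component. -/
def IsConnected : Prop := Nonempty Γ.Components ∧ Subsingleton Γ.Components

/-- The valency of a vertex; a loop counts twice. -/
def valency (v : Γ.V) : ℕ := Nat.card {h : Γ.H // Γ.vert h = v}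

/-- A graph is a cycle if it is connected and has, for some `n ≥ 1`, exactly `n` edges and
`n` vertices, each of valency two. -/
def IsCycle : Prop :=
  Γ.IsConnected ∧ ∃ n : ℕ, 1 ≤ n ∧ Nat.card Γ.E = n ∧ Nat.card Γ.V = n ∧ ∀ v, Γ.valency v = 2

/-- The graph `Γ ∖ S`: remove the edges in `S`, leave everything else unchanged. -/
def delete (S : Set Γ.E) : HGraph.{u} where
  V := Γ.V
  E := {e : Γ.E // e ∉ S}
  H := {h : Γ.H // Γ.edge h ∉ S}
  edge h := ⟨Γ.edge h.1, h.2⟩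
  vert h := Γ.vert h.1
  two_halves := by
    rintro ⟨e, he⟩
    obtain ⟨a, b, hab, H⟩ := Γ.two_halves e
    refine ⟨⟨a, by rwa [(H a).2 (Or.inl rfl)]⟩, ⟨b, by rwa [(H b).2 (Or.inr rfl)]⟩, ?_, ?_⟩
    · simpa using hab
    · rintro ⟨h, hh⟩
      simpa using H h

/-- The graph `Γ(S)`: contract every edge that is not in `S`.  Its edges are the elements of `S` and
its vertices are the connected components of `Γ ∖ S`. -/
def contract (S : Set Γ.E) : HGraph.{u} where
  V := (Γ.delete S).Components
  E := {e : Γ.E // e ∈ S}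
  H := {h : Γ.H // Γ.edge h ∈ S}
  edge h := ⟨Γ.edge h.1, h.2⟩
  vert h := Quot.mk _ (Γ.vert h.1)
  two_halves := by
    rintro ⟨e, he⟩
    obtain ⟨a, b, hab, H⟩ := Γ.two_halves e
    refine ⟨⟨a, by rwa [(H a).2 (Or.inl rfl)]⟩, ⟨b, by rwa [(H b).2 (Or.inr rfl)]⟩, ?_, ?_⟩
    · simpa using hab
    · rintro ⟨h, hh⟩
      simpa using H h

/-- The subgraph of `Γ` formed by the edges in `Z` and their end vertices. -/
def spanned (Z : Set Γ.E) : HGraph.{u} where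
  V := {v : Γ.V // ∃ h : Γ.H, Γ.edge h ∈ Z ∧ Γ.vert h = v}
  E := {e : Γ.E // e ∈ Z}
  H := {h : Γ.H // Γ.edge h ∈ Z}
  edge h := ⟨Γ.edge h.1, h.2⟩
  vert h := ⟨Γ.vert h.1, h.1, h.2, rfl⟩
  two_halves := by
    rintro ⟨e, he⟩
    obtain ⟨a, b, hab, H⟩ := Γ.two_halves e
    refine ⟨⟨a, by rwa [(H a).2 (Or.inl rfl)]⟩, ⟨b, by rwa [(H b).2 (Or.inr rfl)]⟩, ?_, ?_⟩
    · simpa using hab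
    · rintro ⟨h, hh⟩
      simpa using H h

/-- `Z` is the edge set of a cycle of `Γ`.  (A cycle of `Γ` is a subgraph that is a cycle; having no
isolated vertices it is determined by its edges.) -/
def IsCycleIn (Z : Set Γ.E) : Prop := (Γ.spanned Z).IsCycle

/-- An edge is separating if removing it increases the number of connected components. -/
def IsSeparating (e : Γ.E) : Prop :=
  ENat.card Γ.Components < ENat.card (Γ.delete {e}).Components

/-- `S` is a C1-set of `Γ`: the graph `Γ ∖ S` has no separating edge, and `Γ(S)` is a cycle. -/
def IsC1Set (S : Set Γ.E) : Prop :=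
  (∀ e, ¬ (Γ.delete S).IsSeparating e) ∧ (Γ.contract S).IsCycle

/-- A cyclic bijection: a bijection of the edges that induces a bijection of the cycles. -/
def IsCyclicBijection {Γ Γ' : HGraph.{u}} (ε : Γ.E ≃ Γ'.E) : Prop :=
  ∀ Z : Set Γ.E, Γ.IsCycleIn Z ↔ Γ'.IsCycleIn (ε '' Z)

/-- An orientation: each edge is given a source half-edge and a target half-edge.  (For a loop this
is the choice of a direction in which to run through it.) -/
structure Orientation where
  src : Γ.E → Γ.H
  tgt : Γ.E → Γ.H
  edge_src : ∀ e, Γ.edge (src e) = e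
  edge_tgt : ∀ e, Γ.edge (tgt e) = e
  src_ne_tgt : ∀ e, src e ≠ tgt e

variable {Γ}

/-- The boundary map `C₁(Γ, ℤ) → C₀(Γ, ℤ)`, `e ↦ t(e) - s(e)`. -/
def boundary (o : Γ.Orientation) : (Γ.E →₀ ℤ) →+ (Γ.V →₀ ℤ) :=
  Finsupp.mapDomain.addMonoidHom (fun e => Γ.vert (o.tgt e)) -
    Finsupp.mapDomain.addMonoidHom (fun e => Γ.vert (o.src e))

/-- `H₁(Γ, ℤ) = ker ∂`. -/
def H1 (o : Γ.Orientation) : AddSubgroup (Γ.E →₀ ℤ) := (boundary o).ker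

/-- The isomorphism `ε_C : C₁(Γ, ℤ) ≅ C₁(Γ', ℤ)` induced by a bijection of the edges. -/
def chainEquiv {Γ Γ' : HGraph.{u}} (ε : Γ.E ≃ Γ'.E) : (Γ.E →₀ ℤ) ≃+ (Γ'.E →₀ ℤ) :=
  Finsupp.domCongr ε

end HGraph

/-! ## Divisors -/

/-- The group of divisors `Div N` of a smooth curve `N`: the free abelian group on the closed
points. -/
abbrev CurveDiv (N : Scheme.{u}) : Type u := closedPoints N →₀ ℤ

/-- The multidegree of a divisor: its degree on every connected component. -/
def multidegree (N : Scheme.{u}) : CurveDiv N →+ (ConnectedComponents N →₀ ℤ) :=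
  Finsupp.mapDomain.addMonoidHom (fun q => ConnectedComponents.mk q.1)

/-- The group of divisors that have degree `0` on every connected component. -/
def CurveDiv0 (N : Scheme.{u}) : AddSubgroup (CurveDiv N) := (multidegree N).ker

/-- The action of a choice of signs `α`, one for each connected component, on divisors: the part of a
divisor on a component is multiplied by the sign of this component. -/
def signAction {N : Scheme.{u}} (α : ConnectedComponents N → ℤˣ) : CurveDiv N →+ CurveDiv N where
  toFun D := Finsupp.onFinset D.support
    (fun q => (α (ConnectedComponents.mk q.1) : ℤ) * D q) (by
      intro q hq
      rw [Finsupp.mem_support_iff]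
      exact right_ne_zero_of_mul hq)
  map_zero' := by ext q; simp
  map_add' D D' := by ext q; simp [mul_add]

@[simp] lemma signAction_apply {N : Scheme.{u}} (α : ConnectedComponents N → ℤˣ) (D : CurveDiv N)
    (q : closedPoints N) :
    signAction α D q = (α (ConnectedComponents.mk q.1) : ℤ) * D q := rfl

lemma signAction_single {N : Scheme.{u}} (α : ConnectedComponents N → ℤˣ) (q : closedPoints N)
    (n : ℤ) : signAction α (Finsupp.single q n) =
      Finsupp.single q ((α (ConnectedComponents.mk q.1) : ℤ) * n) := by
  ext r
  rw [signAction_apply]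
  by_cases h : q = r
  · subst h; simp
  · simp [Finsupp.single_eq_of_ne' h]

lemma multidegree_signAction {N : Scheme.{u}} (α : ConnectedComponents N → ℤˣ) (D : CurveDiv N)
    (c : ConnectedComponents N) :
    multidegree N (signAction α D) c = (α c : ℤ) * multidegree N D c := by
  induction D using Finsupp.induction_linear with
  | zero => simp
  | add f g hf hg => simp [hf, hg, mul_add]
  | single q n =>
    rw [signAction_single]
    simp only [multidegree, Finsupp.mapDomain.addMonoidHom_apply, Finsupp.mapDomain_single]
    by_cases h : ConnectedComponents.mk q.1 = c
    · subst h; simp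
    · simp [Finsupp.single_eq_of_ne' h]

/-- The action of `K_γ = {±1}^γ` on the group of divisors of degree `0` on every component. -/
def signAction0 {N : Scheme.{u}} (α : ConnectedComponents N → ℤˣ) : CurveDiv0 N →+ CurveDiv0 N :=
  ((signAction α).comp (CurveDiv0 N).subtype).codRestrict (CurveDiv0 N) (by
    intro D
    have h : multidegree N D.1 = 0 := D.2
    change multidegree N (signAction α D.1) = 0
    ext c
    rw [multidegree_signAction, h]
    simp)

/-- The bijection of closed points given by an isomorphism. -/
def closedPointsEquiv {N N' : Scheme.{u}} (φ : N ≅ N') : closedPoints N ≃ closedPoints N' :=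
  (Scheme.homeoOfIso φ).toEquiv.subtypeEquiv (fun q => by
    change IsClosed {q} ↔ IsClosed {Scheme.homeoOfIso φ q}
    rw [← Set.image_singleton, (Scheme.homeoOfIso φ).isClosed_image])

/-- The isomorphism of divisor groups given by an isomorphism of curves. -/
def divEquiv {N N' : Scheme.{u}} (φ : N ≅ N') : CurveDiv N ≃+ CurveDiv N' :=
  Finsupp.domCongr (closedPointsEquiv φ)

lemma multidegree_divEquiv {N N' : Scheme.{u}} (φ : N ≅ N') (D : CurveDiv N) :
    multidegree N' (divEquiv φ D) = Finsupp.mapDomain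
      (Scheme.homeoOfIso φ).continuous.connectedComponentsMap (multidegree N D) := by
  simp only [multidegree, Finsupp.mapDomain.addMonoidHom_apply, divEquiv, Finsupp.domCongr_apply,
    Finsupp.equivMapDomain_eq_mapDomain, ← Finsupp.mapDomain_comp]
  rfl

/-- The map `φ_D` on divisors of degree `0` on every component given by an isomorphism of curves. -/
def divMap0 {N N' : Scheme.{u}} (φ : N ≅ N') : CurveDiv0 N →+ CurveDiv0 N' :=
  ((divEquiv φ).toAddMonoidHom.comp (CurveDiv0 N).subtype).codRestrict (CurveDiv0 N') (by
    intro D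
    have h : multidegree N D.1 = 0 := D.2
    change multidegree N' (divEquiv φ D.1) = 0
    rw [multidegree_divEquiv, h, Finsupp.mapDomain_zero])

/-! ## Nodal curves -/

/-- `ν : N ⟶ X` is the normalization of the (reduced) scheme `X`: it is finite and birational, and
`N` is normal. -/
structure IsNormalization {N X : Scheme.{u}} (ν : N ⟶ X) : Prop where
  normal : ∀ x : N, IsDomain (N.presheaf.stalk x) ∧ IsIntegrallyClosed (N.presheaf.stalk x)
  finite : IsFinite ν
  birational : ∃ U : X.Opens, Dense (U : Set X) ∧ Dense ((ν ⁻¹ᵁ U : N.Opens) : Set N) ∧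
    IsIso (ν ∣_ U)

/-- The singular points of a reduced curve of pure dimension one: the closed points whose local ring
is not a discrete valuation ring (equivalently, is not regular). -/
def singularPoints (X : Scheme.{u}) : Set X :=
  {p | IsClosed {p} ∧
    ¬ ∃ _ : IsDomain (X.presheaf.stalk p), IsDiscreteValuationRing (X.presheaf.stalk p)}

section Field

variable {k : Type u} [Field k]

/-- The constant functions on an open subset of a `k`-scheme. -/
def constantSection (X : Over (Spec (CommRingCat.of k))) (U : X.left.Opens) : k →+* Γ(X.left, U) :=
  ((Scheme.ΓSpecIso (CommRingCat.of k)).inv ≫ X.hom.appLE ⊤ U le_top).hom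

/-- The point `p` of the curve `X` with normalization `ν : N ⟶ X` is a node (an ordinary double
point): it has exactly two preimages `q₁`, `q₂` in `N`, and near `p` the functions on `X` are precisely
the functions `f` on `N` with `f(q₁) = f(q₂)`; that is, `X` is obtained near `p` from `N` by gluing
`q₁` and `q₂` transversally (two branches, and `δ`-invariant one).
A function `f` takes the value `c ∈ k` at `q` if and only if `q` is not in the open set where `f - c`
is invertible. -/
def IsNode {N X : Over (Spec (CommRingCat.of k))} (ν : N ⟶ X) (p : X.left) : Prop :=
  ∃ q₁ q₂ : N.left, q₁ ≠ q₂ ∧ (∀ q, ν.left q = p ↔ q = q₁ ∨ q = q₂) ∧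
    ∃ U : X.left.Opens, IsAffineOpen U ∧ p ∈ U ∧
      ∀ f : Γ(N.left, ν.left ⁻¹ᵁ U),
        (∃ g : Γ(X.left, U), ν.left.app U g = f) ↔
        (∃ c : k, q₁ ∉ N.left.basicOpen (f - constantSection N (ν.left ⁻¹ᵁ U) c) ∧
          q₂ ∉ N.left.basicOpen (f - constantSection N (ν.left ⁻¹ᵁ U) c))

end Field

/-- A nodal curve over an algebraically closed field `k` together with its normalization: a reduced
proper (for curves this is the same as projective) `k`-scheme of pure dimension one all of whose
singular points are nodes. -/
structure NodalCurve (k : Type u) [Field k] [IsAlgClosed k] where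
  /-- the curve -/
  X : Over (Spec (CommRingCat.of k))
  proper : IsProper X.hom
  reduced : IsReduced X.left
  pureDimOne : ∀ Z ∈ irreducibleComponents X.left, topologicalKrullDim Z = 1
  /-- the normalization of the curve -/
  N : Over (Spec (CommRingCat.of k))
  /-- the normalization map -/
  ν : N ⟶ X
  isNormalization : IsNormalization ν.left
  nodal : ∀ p ∈ singularPoints X.left, IsNode ν p

namespace NodalCurve

variable {k : Type u} [Field k] [IsAlgClosed k] (C : NodalCurve k)

/-- The nodes of `X`. -/
abbrev nodes : Set C.X.left := singularPoints C.X.left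

/-- A node is separating if removing it increases the number of connected components of `X`. -/
def IsSeparatingNode (p : C.X.left) : Prop :=
  p ∈ C.nodes ∧
    ENat.card (ConnectedComponents C.X.left) <
      ENat.card (ConnectedComponents (({p} : Set C.X.left)ᶜ : Set C.X.left))

/-- The gluing points `ν⁻¹(S)` over a set `S` of nodes. -/
def gluingSet (S : Set C.nodes) : Set C.N.left :=
  {q | ∃ h : C.ν.left q ∈ C.nodes, (⟨C.ν.left q, h⟩ : C.nodes) ∈ S}

/-- The dual graph `Γ_X`.  Its vertices are the components `C_i` of the normalization (these
correspond to the irreducible components of `X`), its edges are the nodes of `X`, and the two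
half-edges of the edge `p` are the two points of the normalization over the node `p`, each attached to
the component on which it lies. -/
def dualGraph : HGraph.{u} where
  V := ConnectedComponents C.N.left
  E := C.nodes
  H := {q : C.N.left // C.ν.left q ∈ C.nodes}
  edge q := ⟨C.ν.left q.1, q.2⟩
  vert q := ConnectedComponents.mk q.1
  two_halves := by
    rintro ⟨p, hp⟩
    obtain ⟨a, b, hab, H, -⟩ := C.nodal p hp
    refine ⟨⟨a, by rwa [(H a).2 (Or.inl rfl)]⟩, ⟨b, by rwa [(H b).2 (Or.inr rfl)]⟩, ?_, ?_⟩
    · simpa using hab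
    · rintro ⟨q, hq⟩
      simpa using H q

lemma isClosed_half (q : C.dualGraph.H) : IsClosed ({q.1} : Set C.N.left) := by
  have := C.isNormalization.finite
  have hcl : IsClosed (C.ν.left ⁻¹' {C.ν.left q.1}) := q.2.1.preimage C.ν.left.continuous
  have hd : DiscreteTopology (C.ν.left ⁻¹' {C.ν.left q.1} : Set C.N.left) :=
    (C.ν.left.isDiscrete_preimage_singleton (C.ν.left q.1)).to_subtype
  have h := hcl.isClosedEmbedding_subtypeVal.isClosedMap
    {(⟨q.1, rfl⟩ : (C.ν.left ⁻¹' {C.ν.left q.1} : Set C.N.left))} (isClosed_discrete _)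
  simpa using h

/-- A half-edge as a closed point of the normalization. -/
def halfPoint (q : C.dualGraph.H) : closedPoints C.N.left := ⟨q.1, C.isClosed_half q⟩

variable {C}

/-- The map `η̃ : C₁(Γ_X, ℤ) → Div N`, `e ↦ t_e - s_e`. -/
def etaTilde (o : C.dualGraph.Orientation) : (C.dualGraph.E →₀ ℤ) →+ CurveDiv C.N.left :=
  Finsupp.mapDomain.addMonoidHom (fun e => C.halfPoint (o.tgt e)) -
    Finsupp.mapDomain.addMonoidHom (fun e => C.halfPoint (o.src e))

lemma multidegree_etaTilde (o : C.dualGraph.Orientation) (c : C.dualGraph.E →₀ ℤ) :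
    multidegree C.N.left (etaTilde o c) = HGraph.boundary o c := by
  simp only [multidegree, etaTilde, HGraph.boundary, AddMonoidHom.sub_apply, map_sub,
    Finsupp.mapDomain.addMonoidHom_apply, ← Finsupp.mapDomain_comp]
  rfl

/-- The map `η : H₁(Γ_X, ℤ) → Div⁰ N`, the restriction of `η̃`. -/
def eta (o : C.dualGraph.Orientation) : HGraph.H1 o →+ CurveDiv0 C.N.left :=
  ((etaTilde o).comp (HGraph.H1 o).subtype).codRestrict (CurveDiv0 C.N.left) (by
    intro c
    change multidegree C.N.left (etaTilde o c.1) = 0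
    rw [multidegree_etaTilde]
    exact c.2)

/-- C1-equivalence (for connected nodal curves free from separating nodes). -/
def C1Equivalent (C C' : NodalCurve k) : Prop :=
  ∃ φ : C.N ≅ C'.N,
  ∃ β : {S : Set C.dualGraph.E // C.dualGraph.IsC1Set S} ≃
      {S' : Set C'.dualGraph.E // C'.dualGraph.IsC1Set S'},
    ∀ S, φ.hom.left '' C.gluingSet S.1 = C'.gluingSet (β S).1

/-- T-equivalence (for connected nodal curves): an isomorphism `φ` of the normalizations and a cyclic
bijection `ε` of the dual graphs such that for every orientation `o` of `Γ_X` there are an orientation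
`o'` of `Γ_{X'}`, for which `ε` maps `H₁(Γ_X, ℤ)` onto `H₁(Γ_{X'}, ℤ)`, and signs `α ∈ {±1}^γ` with
`φ_D ∘ α ∘ η_X = η_{X'} ∘ ε_H`. -/
def TEquivalent (C C' : NodalCurve k) : Prop :=
  ∃ (φ : C.N ≅ C'.N) (ε : C.dualGraph.E ≃ C'.dualGraph.E), HGraph.IsCyclicBijection ε ∧
    ∀ o : C.dualGraph.Orientation, ∃ (o' : C'.dualGraph.Orientation)
      (hH : ∀ c, c ∈ HGraph.H1 o ↔ HGraph.chainEquiv ε c ∈ HGraph.H1 o')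
      (α : ConnectedComponents C.N.left → ℤˣ),
      ∀ c : HGraph.H1 o,
        divMap0 ((Over.forget _).mapIso φ) (signAction0 α (eta o c)) =
          eta o' ⟨HGraph.chainEquiv ε c.1, (hH c.1).1 c.2⟩

end NodalCurve

end

/-!
The statement is about the dual graphs, once three facts about a connected nodal curve `X` with
normalization `N` are known: the dual graph is finite, it is connected, and an edge that separates
it gives a separating node (`finite_nodes`, `isConnected_dualGraph`,
`isSeparatingNode_of_isSeparating`). The normalization map is bijective over a dense open set, which
contains no node because a node has two preimages, so there are finitely many nodes. The local
ring of any other closed point outside this set is a domain, so the point has an irreducible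
neighbourhood and its preimages in `N` lie on one component; hence the images of two complementary
unions of components of `N` can meet only in nodes.

A chain `c` on a graph is viewed as an antisymmetric function on the half-edges, its flow
(`HGraph.flow`). The boundary of `c` and the divisor `η̃(c)` are the pushforwards of the flow to
the vertices and to the points of `N`. Two edges are coupled if the same cycle classes vanish on
them. In a connected graph without separating edges, the C1-sets are exactly the classes of
coupled edges (`isC1Set_iff_eq_coupledClass`), so they partition the edges; and the cycles are the
minimal supports of cycle classes (`isCycleIn_iff`), by Euler's formula.

*T-equivalence implies C1-equivalence.* Signs do not change supports, so `φ` maps the gluing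
points over the support of a cycle class `c` to those over the support of `ε(c)`. As `ε` preserves
cycle classes, it preserves the coupling of edges, and the gluing points over a class of coupled
edges are determined by these supports (`image_gluingSet_coupledClass`).

*C1-equivalence implies T-equivalence.* Now the two graphs have the same vertices, half-edges and
C1-sets, but the half-edges may be joined differently (`HGraph.Regluing`). Removing a C1-set `S`
leaves components that depend only on this common data (`Regluing.delComp_eq`), because every
other C1-set has all its ends in one component of `Γ ∖ S`. Each component carries exactly two
half-edges over `S`, which have opposite signs in the cyclic orientation of `S` in either graph.
The two cyclic orientations thus differ by a sign on each component of `Γ ∖ S`, that is, by a sign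
`β_S(v)` for each vertex `v`. Put `α(v) = ∏_S β_S(v)`. If `v` and `w` are ends of edges in `T`,
then `β_S(v) = β_S(w)` for all `S ≠ T`, so `α` and `β_T` agree on the ends of the edges in `T` up
to a common sign (`Regluing.exists_vertex_signs`). As every cycle class is a multiple of the
cyclic orientation on each C1-set, the signs `α` turn the flows of one graph into those of the
other for any bijection of the edges that is compatible with the C1-sets
(`Regluing.exists_orientation_signs`).
-/

noncomputable section

namespace HGraph

variable {Γ : HGraph.{u}}

/-! ### Half-edges and flows -/

lemma eq_or_eq_of_edge_eq {h₁ h₂ h : Γ.H} (hne : h₁ ≠ h₂) (h12 : Γ.edge h₁ = Γ.edge h₂)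
    (h1 : Γ.edge h = Γ.edge h₁) : h = h₁ ∨ h = h₂ := by
  obtain ⟨a, b, -, H⟩ := Γ.two_halves (Γ.edge h₁)
  have e1 := (H h₁).1 rfl
  have e2 := (H h₂).1 h12.symm
  have e3 := (H h).1 h1
  grind

namespace Orientation

variable (o : Γ.Orientation)

lemma tgt_or_src (h : Γ.H) : o.tgt (Γ.edge h) = h ∨ o.src (Γ.edge h) = h := by
  have := eq_or_eq_of_edge_eq (h := h) (o.src_ne_tgt (Γ.edge h)).symm
    ((o.edge_tgt _).trans (o.edge_src _).symm) (o.edge_tgt _).symm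
  grind

open Classical in
/-- The sign of a half-edge: `1` for the target and `-1` for the source of an edge. -/
def sgn (h : Γ.H) : ℤˣ := if o.tgt (Γ.edge h) = h then 1 else -1

@[simp] lemma sgn_tgt (e : Γ.E) : o.sgn (o.tgt e) = 1 := by
  simp [sgn, o.edge_tgt]

@[simp] lemma sgn_src (e : Γ.E) : o.sgn (o.src e) = -1 := by
  simp [sgn, o.edge_src, (o.src_ne_tgt e).symm]

lemma sgn_opp {h h' : Γ.H} (hne : h ≠ h') (he : Γ.edge h = Γ.edge h') : o.sgn h' = - o.sgn h := by
  rcases o.tgt_or_src h with h1 | h1 <;> rcases o.tgt_or_src h' with h2 | h2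
  · exact absurd (h1.symm.trans ((congrArg _ he).trans h2)) hne
  · rw [← h1, ← h2]; simp
  · rw [← h1, ← h2]; simp
  · exact absurd (h1.symm.trans ((congrArg _ he).trans h2)) hne

end Orientation

/-- Every antisymmetric choice of signs on the half-edges comes from an orientation. -/
lemma exists_orientation (s : Γ.H → ℤˣ)
    (hs : ∀ h h', h ≠ h' → Γ.edge h = Γ.edge h' → s h' = - s h) :
    ∃ o : Γ.Orientation, ∀ h, o.sgn h = s h := by
  have key : ∀ e : Γ.E, ∃ p : Γ.H × Γ.H, Γ.edge p.1 = e ∧ Γ.edge p.2 = e ∧ p.1 ≠ p.2 ∧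
      s p.1 = -1 ∧ s p.2 = 1 := by
    intro e
    obtain ⟨a, b, hab, H⟩ := Γ.two_halves e
    have ha := (H a).2 (Or.inl rfl)
    have hb := (H b).2 (Or.inr rfl)
    have := hs a b hab (ha.trans hb.symm)
    rcases Int.units_eq_one_or (s a) with h | h
    · exact ⟨(b, a), hb, ha, hab.symm, by simp [this, h], h⟩
    · exact ⟨(a, b), ha, hb, hab, h, by simp [this, h]⟩
  choose p h1 h2 h3 h4 h5 using key
  refine ⟨⟨fun e => (p e).1, fun e => (p e).2, h1, h2, h3⟩, fun h => ?_⟩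
  set o : Γ.Orientation := ⟨fun e => (p e).1, fun e => (p e).2, h1, h2, h3⟩
  rcases o.tgt_or_src h with h' | h'
  · rw [← h', o.sgn_tgt]; exact (h5 _).symm
  · rw [← h', o.sgn_src]; exact (h4 _).symm

instance : Nonempty Γ.Orientation := by
  have : ∀ e : Γ.E, ∃ p : Γ.H × Γ.H, Γ.edge p.1 = e ∧ Γ.edge p.2 = e ∧ p.1 ≠ p.2 := by
    intro e
    obtain ⟨a, b, hab, H⟩ := Γ.two_halves e
    exact ⟨(a, b), (H a).2 (Or.inl rfl), (H b).2 (Or.inr rfl), hab⟩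
  choose p h1 h2 h3 using this
  exact ⟨⟨fun e => (p e).1, fun e => (p e).2, h1, h2, h3⟩⟩

/-- A chain `c` seen as an antisymmetric function on the half-edges: its value is `c e` at the
target and `-c e` at the source of `e`. -/
def flow (o : Γ.Orientation) : (Γ.E →₀ ℤ) →+ (Γ.H →₀ ℤ) :=
  Finsupp.mapDomain.addMonoidHom o.tgt - Finsupp.mapDomain.addMonoidHom o.src

lemma flow_apply (o : Γ.Orientation) (c : Γ.E →₀ ℤ) (h : Γ.H) :
    flow o c h = o.sgn h * c (Γ.edge h) := by
  have ht : Function.Injective o.tgt := fun a b h => by rw [← o.edge_tgt a, h, o.edge_tgt]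
  have hs : Function.Injective o.src := fun a b h => by rw [← o.edge_src a, h, o.edge_src]
  simp only [flow, AddMonoidHom.sub_apply, Finsupp.mapDomain.addMonoidHom_apply, Finsupp.sub_apply]
  rcases o.tgt_or_src h with h' | h'
  · rw [← h', Finsupp.mapDomain_apply ht, Finsupp.mapDomain_of_notMem_range]
    · simp [o.edge_tgt]
    · rintro ⟨e, he⟩
      have : e = Γ.edge h := by rw [← o.edge_src e, he, o.edge_tgt]
      exact o.src_ne_tgt _ (this ▸ he)
  · rw [← h', Finsupp.mapDomain_apply hs, Finsupp.mapDomain_of_notMem_range]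
    · simp [o.edge_src]
    · rintro ⟨e, he⟩
      have : e = Γ.edge h := by rw [← o.edge_tgt e, he, o.edge_src]
      exact o.src_ne_tgt _ (this ▸ he).symm

lemma boundary_eq (o : Γ.Orientation) (c : Γ.E →₀ ℤ) :
    boundary o c = Finsupp.mapDomain Γ.vert (flow o c) := by
  have := (Finsupp.mapDomain.addMonoidHom (M := ℤ) Γ.vert).map_sub
    (Finsupp.mapDomain o.tgt c) (Finsupp.mapDomain o.src c)
  simp only [Finsupp.mapDomain.addMonoidHom_apply] at this
  simp only [flow, boundary, AddMonoidHom.sub_apply, Finsupp.mapDomain.addMonoidHom_apply, this,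
    ← Finsupp.mapDomain_comp]
  rfl

lemma mem_H1 {o : Γ.Orientation} {c : Γ.E →₀ ℤ} : c ∈ H1 o ↔ boundary o c = 0 := Iff.rfl

lemma mem_H1_iff {o : Γ.Orientation} {c : Γ.E →₀ ℤ} :
    c ∈ H1 o ↔ Finsupp.mapDomain Γ.vert (flow o c) = 0 := by
  rw [mem_H1, boundary_eq]

lemma boundary_single (o : Γ.Orientation) (e : Γ.E) (n : ℤ) :
    boundary o (Finsupp.single e n) =
      Finsupp.single (Γ.vert (o.tgt e)) n - Finsupp.single (Γ.vert (o.src e)) n := by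
  simp [boundary, Finsupp.mapDomain_single]

/-- Multiplying the coefficients over each fibre of `f` by a common factor commutes with pushing
forward along `f`. -/
lemma mapDomain_mul_apply {A B : Type*} (f : A → B) (g : B → ℤ) (x y : A →₀ ℤ)
    (hy : ∀ a, y a = g (f a) * x a) (b : B) :
    Finsupp.mapDomain f y b = g b * Finsupp.mapDomain f x b := by
  have : y = (fun a => g (f a)) • x := by
    ext a; simp [hy]
  subst this
  clear hy
  induction x using Finsupp.induction_linear with
  | zero => simp
  | add x y hx hy => simp [smul_add, Finsupp.mapDomain_add, hx, hy, mul_add]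
  | single a n =>
    have : (fun a => g (f a)) • Finsupp.single a n = Finsupp.single a (g (f a) * n) := by
      ext a'
      by_cases h : a = a'
      · subst h; simp
      · simp [Finsupp.single_eq_of_ne' h]
    rw [this, Finsupp.mapDomain_single, Finsupp.mapDomain_single]
    by_cases h : f a = b
    · subst h; simp
    · simp [Finsupp.single_eq_of_ne' h]

/-! ### Connected components and the image of the boundary map -/

/-- The connected component of a vertex. -/
def comp (v : Γ.V) : Γ.Components := Quot.mk _ v

lemma comp_vert_eq {h h' : Γ.H} (he : Γ.edge h = Γ.edge h') :
    comp (Γ.vert h) = comp (Γ.vert h') := by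
  by_cases hne : h = h'
  · rw [hne]
  · exact Quot.sound ⟨h, h', hne, he, rfl, rfl⟩

lemma mapDomain_comp_boundary (o : Γ.Orientation) (c : Γ.E →₀ ℤ) :
    Finsupp.mapDomain comp (boundary o c) = 0 := by
  induction c using Finsupp.induction_linear with
  | zero => simp
  | add f g hf hg => rw [map_add, Finsupp.mapDomain_add, hf, hg, add_zero]
  | single e n =>
    have := (Finsupp.mapDomain.addMonoidHom (M := ℤ) (comp (Γ := Γ))).map_sub
      (Finsupp.single (Γ.vert (o.tgt e)) n) (Finsupp.single (Γ.vert (o.src e)) n)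
    simp only [Finsupp.mapDomain.addMonoidHom_apply] at this
    rw [boundary_single, this, Finsupp.mapDomain_single, Finsupp.mapDomain_single,
      comp_vert_eq (h := o.tgt e) (h' := o.src e) (by rw [o.edge_tgt, o.edge_src]), sub_self]

/-- A `0`-chain of degree `0` on every connected component is a boundary: the quotient of the
`0`-chains by the boundaries receives a map from the free group on the components. -/
lemma exists_boundary_eq (o : Γ.Orientation) (x : Γ.V →₀ ℤ)
    (hx : Finsupp.mapDomain (comp (Γ := Γ)) x = 0) : ∃ c, boundary o c = x := by
  let R := (boundary o).range
  let q : Γ.V → (Γ.V →₀ ℤ) ⧸ R := fun v => QuotientAddGroup.mk' R (Finsupp.single v 1)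
  have hq : ∀ v w, Γ.Adj v w → q v = q w := by
    rintro _ _ ⟨h, h', hne, he, rfl, rfl⟩
    have key : ∀ e, q (Γ.vert (o.tgt e)) = q (Γ.vert (o.src e)) := by
      intro e
      rw [← sub_eq_zero]
      simp only [q]
      rw [← map_sub, ← boundary_single, QuotientAddGroup.mk'_apply, QuotientAddGroup.eq_zero_iff]
      exact ⟨_, rfl⟩
    have := key (Γ.edge h)
    rcases o.tgt_or_src h with h1 | h1 <;> rcases o.tgt_or_src h' with h2 | h2 <;>
      rw [← he] at h2
    · exact absurd (h1.symm.trans h2) hne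
    · rwa [h1, h2] at this
    · rw [h1, h2] at this; exact this.symm
    · exact absurd (h1.symm.trans h2) hne
  let F : (Γ.Components →₀ ℤ) →+ (Γ.V →₀ ℤ) ⧸ R :=
    Finsupp.liftAddHom fun K => (zmultiplesHom _ (Quot.lift q hq K))
  have hF : ∀ y : Γ.V →₀ ℤ, F (Finsupp.mapDomain comp y) = QuotientAddGroup.mk' R y := by
    intro y
    induction y using Finsupp.induction_linear with
    | zero => simp
    | add f g hf hg => rw [Finsupp.mapDomain_add, map_add, map_add, hf, hg]
    | single v n =>
      rw [Finsupp.mapDomain_single]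
      have : Finsupp.single v n = n • Finsupp.single v (1 : ℤ) := by simp
      rw [this, map_zsmul]
      exact Finsupp.liftAddHom_apply_single _ _ _
  have h0 := hF x
  rw [hx, map_zero, eq_comm, QuotientAddGroup.mk'_apply, QuotientAddGroup.eq_zero_iff] at h0
  exact h0

/-- The component of an edge. -/
def edgeComp (o : Γ.Orientation) (e : Γ.E) : Γ.Components := comp (Γ.vert (o.tgt e))

lemma edgeComp_edge (o : Γ.Orientation) (h : Γ.H) :
    edgeComp o (Γ.edge h) = comp (Γ.vert h) := comp_vert_eq (o.edge_tgt _)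

/-- A cycle class may be rescaled on every connected component separately. -/
lemma weight_mem_H1 {o : Γ.Orientation} {c : Γ.E →₀ ℤ} (hc : c ∈ H1 o) (g : Γ.Components → ℤ) :
    (fun e => g (edgeComp o e)) • c ∈ H1 o := by
  rw [mem_H1_iff] at hc ⊢
  ext v
  rw [mapDomain_mul_apply Γ.vert (fun v => g (comp v)) (flow o c), hc]
  · simp
  · intro h
    rw [flow_apply, flow_apply, Finsupp.coe_pointwise_smul, Pi.smul_apply', edgeComp_edge]
    simp only [smul_eq_mul]
    ring

/-! ### Deleting, contracting and spanning -/

/-- The orientation of `Γ ∖ S` induced by an orientation of `Γ`. -/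
def Orientation.delete (o : Γ.Orientation) (S : Set Γ.E) : (Γ.delete S).Orientation where
  src e := ⟨o.src e.1, by rw [o.edge_src]; exact e.2⟩
  tgt e := ⟨o.tgt e.1, by rw [o.edge_tgt]; exact e.2⟩
  edge_src e := Subtype.ext (o.edge_src _)
  edge_tgt e := Subtype.ext (o.edge_tgt _)
  src_ne_tgt e h := o.src_ne_tgt e.1 (congrArg Subtype.val h)

/-- The orientation of `Γ(S)` induced by an orientation of `Γ`. -/
def Orientation.contract (o : Γ.Orientation) (S : Set Γ.E) : (Γ.contract S).Orientation where
  src e := ⟨o.src e.1, by rw [o.edge_src]; exact e.2⟩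
  tgt e := ⟨o.tgt e.1, by rw [o.edge_tgt]; exact e.2⟩
  edge_src e := Subtype.ext (o.edge_src _)
  edge_tgt e := Subtype.ext (o.edge_tgt _)
  src_ne_tgt e h := o.src_ne_tgt e.1 (congrArg Subtype.val h)

/-- The orientation of the subgraph spanned by `Z` induced by an orientation of `Γ`. -/
def Orientation.spanned (o : Γ.Orientation) (Z : Set Γ.E) : (Γ.spanned Z).Orientation where
  src e := ⟨o.src e.1, by rw [o.edge_src]; exact e.2⟩
  tgt e := ⟨o.tgt e.1, by rw [o.edge_tgt]; exact e.2⟩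
  edge_src e := Subtype.ext (o.edge_src _)
  edge_tgt e := Subtype.ext (o.edge_tgt _)
  src_ne_tgt e h := o.src_ne_tgt e.1 (congrArg Subtype.val h)

/-- The edges of `Γ ∖ S` as edges of `Γ`. -/
def deleteEdge (S : Set Γ.E) : (Γ.delete S).E ↪ Γ.E := ⟨Subtype.val, Subtype.val_injective⟩

/-- The edges of `Γ(S)` as edges of `Γ`. -/
def contractEdge (S : Set Γ.E) : (Γ.contract S).E ↪ Γ.E := ⟨Subtype.val, Subtype.val_injective⟩

/-- The edges of the subgraph spanned by `Z` as edges of `Γ`. -/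
def spannedEdge (Z : Set Γ.E) : (Γ.spanned Z).E ↪ Γ.E := ⟨Subtype.val, Subtype.val_injective⟩

@[simp] lemma range_deleteEdge (S : Set Γ.E) : Set.range (deleteEdge S) = Sᶜ := by
  ext e; exact ⟨fun ⟨x, hx⟩ => hx ▸ x.2, fun h => ⟨⟨e, h⟩, rfl⟩⟩

@[simp] lemma range_contractEdge (S : Set Γ.E) : Set.range (contractEdge S) = S := by
  ext e; exact ⟨fun ⟨x, hx⟩ => hx ▸ x.2, fun h => ⟨⟨e, h⟩, rfl⟩⟩

@[simp] lemma range_spannedEdge (Z : Set Γ.E) : Set.range (spannedEdge Z) = Z := by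
  ext e; exact ⟨fun ⟨x, hx⟩ => hx ▸ x.2, fun h => ⟨⟨e, h⟩, rfl⟩⟩

section Chains

variable {A B : Type u} (i : A ↪ B)

/-- Extension by zero of a chain along an inclusion of sets of edges. -/
abbrev ext (d : A →₀ ℤ) : B →₀ ℤ := Finsupp.mapDomain i d

/-- The restriction of a chain along an inclusion of sets of edges. -/
abbrev res (c : B →₀ ℤ) : A →₀ ℤ := Finsupp.comapDomain i c i.injective.injOn

lemma ext_apply (d : A →₀ ℤ) (a : A) : ext i d (i a) = d a :=
  Finsupp.mapDomain_apply i.injective d a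

lemma ext_apply_notMem (d : A →₀ ℤ) {b : B} (hb : b ∉ Set.range i) : ext i d b = 0 :=
  Finsupp.mapDomain_of_notMem_range _ _ hb

lemma ext_res {c : B →₀ ℤ} (hc : ∀ b ∉ Set.range i, c b = 0) : ext i (res i c) = c := by
  ext b
  by_cases hb : b ∈ Set.range i
  · obtain ⟨a, rfl⟩ := hb
    rw [ext_apply, Finsupp.comapDomain_apply]
  · rw [ext_apply_notMem _ _ hb, hc b hb]

end Chains

/-- Naturality of the boundary map, for maps of edges and vertices compatible with orientations. -/
lemma boundary_natural {Δ : HGraph.{u}} (o' : Δ.Orientation) (o : Γ.Orientation) {W : Type*}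
    (i : Δ.E → Γ.E) (p' : Δ.V → W) (p : Γ.V → W)
    (ht : ∀ e, p' (Δ.vert (o'.tgt e)) = p (Γ.vert (o.tgt (i e))))
    (hs : ∀ e, p' (Δ.vert (o'.src e)) = p (Γ.vert (o.src (i e)))) (d : Δ.E →₀ ℤ) :
    Finsupp.mapDomain p' (boundary o' d) =
      Finsupp.mapDomain p (boundary o (Finsupp.mapDomain i d)) := by
  have sub {X : Type u} (p : X → W) (x y : X →₀ ℤ) :
      Finsupp.mapDomain p (x - y) = Finsupp.mapDomain p x - Finsupp.mapDomain p y :=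
    (Finsupp.mapDomain.addMonoidHom (M := ℤ) p).map_sub x y
  simp only [boundary, AddMonoidHom.sub_apply, Finsupp.mapDomain.addMonoidHom_apply, sub,
    ← Finsupp.mapDomain_comp]
  congr 2
  · funext e; exact ht e
  · funext e; exact hs e

lemma boundary_delete (o : Γ.Orientation) (S : Set Γ.E) (d : (Γ.delete S).E →₀ ℤ) :
    boundary (o.delete S) d = boundary o (ext (deleteEdge S) d) := by
  have := boundary_natural (o.delete S) o (deleteEdge S) (fun v => v) (fun v => v)
    (fun _ => rfl) (fun _ => rfl) d
  exact Finsupp.mapDomain_id.symm.trans (this.trans Finsupp.mapDomain_id)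

lemma boundary_contract (o : Γ.Orientation) (S : Set Γ.E) (d : (Γ.contract S).E →₀ ℤ) :
    boundary (o.contract S) d =
      Finsupp.mapDomain (comp (Γ := Γ.delete S)) (boundary o (ext (contractEdge S) d)) := by
  have := boundary_natural (o.contract S) o (contractEdge S) (fun v => v) (comp (Γ := Γ.delete S))
    (fun _ => rfl) (fun _ => rfl) d
  exact Finsupp.mapDomain_id.symm.trans this

lemma boundary_spanned (o : Γ.Orientation) (Z : Set Γ.E) (d : (Γ.spanned Z).E →₀ ℤ) :
    Finsupp.mapDomain Subtype.val (boundary (o.spanned Z) d) =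
      boundary o (ext (spannedEdge Z) d) := by
  have := boundary_natural (o.spanned Z) o (spannedEdge Z) Subtype.val (fun v => v)
    (fun _ => rfl) (fun _ => rfl) d
  exact this.trans Finsupp.mapDomain_id

lemma mem_H1_delete {o : Γ.Orientation} {S : Set Γ.E} {d : (Γ.delete S).E →₀ ℤ} :
    d ∈ H1 (o.delete S) ↔ ext (deleteEdge S) d ∈ H1 o := by
  rw [mem_H1, mem_H1, boundary_delete]; rfl

lemma mem_H1_spanned {o : Γ.Orientation} {Z : Set Γ.E} {d : (Γ.spanned Z).E →₀ ℤ} :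
    d ∈ H1 (o.spanned Z) ↔ ext (spannedEdge Z) d ∈ H1 o := by
  rw [mem_H1, mem_H1, ← boundary_spanned]
  constructor
  · intro h; rw [h]; exact Finsupp.mapDomain_zero
  · intro h
    exact Finsupp.mapDomain_injective Subtype.val_injective (h.trans Finsupp.mapDomain_zero.symm)

/-- Contracting edges restricts cycle classes to the remaining edges. -/
lemma res_mem_H1_contract {o : Γ.Orientation} (S : Set Γ.E) {c : Γ.E →₀ ℤ} (hc : c ∈ H1 o) :
    res (contractEdge S) c ∈ H1 (o.contract S) := by
  have hdec : c = ext (contractEdge S) (res (contractEdge S) c) +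
      ext (deleteEdge S) (res (deleteEdge S) c) := by
    ext e
    rw [Finsupp.add_apply]
    by_cases he : e ∈ S
    · rw [ext_apply_notMem (deleteEdge S) _ (by simpa using he), add_zero]
      rw [← range_contractEdge S] at he
      obtain ⟨a, rfl⟩ := he
      rw [ext_apply, Finsupp.comapDomain_apply]
    · rw [ext_apply_notMem (contractEdge S) _ (by simpa using he), zero_add]
      have he : e ∈ Sᶜ := he
      rw [← range_deleteEdge S] at he
      obtain ⟨a, rfl⟩ := he
      rw [ext_apply, Finsupp.comapDomain_apply]
  have h1 : boundary o (ext (contractEdge S) (res (contractEdge S) c)) +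
      boundary o (ext (deleteEdge S) (res (deleteEdge S) c)) = 0 := by
    rw [← map_add, ← hdec]; exact hc
  have h2 := mapDomain_comp_boundary (o.delete S) (res (deleteEdge S) c)
  rw [boundary_delete] at h2
  have h3 := congrArg (Finsupp.mapDomain (comp (Γ := Γ.delete S))) h1
  rw [mem_H1, boundary_contract]
  refine Eq.trans ?_ (h3.trans Finsupp.mapDomain_zero)
  refine Eq.trans ?_ Finsupp.mapDomain_add.symm
  exact (add_zero _).symm.trans (congrArg _ h2.symm)

/-- Every cycle class of `Γ(S)` is the restriction of a cycle class of `Γ`. -/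
lemma exists_mem_H1_res_eq {o : Γ.Orientation} {S : Set Γ.E} {d : (Γ.contract S).E →₀ ℤ}
    (hd : d ∈ H1 (o.contract S)) : ∃ c ∈ H1 o, ∀ e, c (contractEdge S e) = d e := by
  rw [mem_H1, boundary_contract] at hd
  obtain ⟨b, hb⟩ := exists_boundary_eq (o.delete S) _ hd
  rw [boundary_delete] at hb
  refine ⟨ext (contractEdge S) d - ext (deleteEdge S) b, ?_, fun e => ?_⟩
  · rw [mem_H1, map_sub, sub_eq_zero]; exact hb.symm
  · rw [Finsupp.sub_apply, ext_apply, ext_apply_notMem, sub_zero]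
    rw [range_deleteEdge, Set.mem_compl_iff, not_not]
    exact e.2

/-! ### Cycles and the first homology group -/

lemma IsConnected.eq_of_edge {α : Sort*} (hc : Γ.IsConnected) (F : Γ.V → α)
    (hF : ∀ h h', Γ.edge h = Γ.edge h' → F (Γ.vert h) = F (Γ.vert h')) (v w : Γ.V) : F v = F w := by
  have : Subsingleton Γ.Components := hc.2
  let G : Γ.Components → α := Quot.lift F (by
    rintro _ _ ⟨h, h', -, he, rfl, rfl⟩
    exact hF h h' he)
  exact congrArg G (Subsingleton.elim (comp v) (comp w))

lemma mapDomain_apply_eq_sum {A B : Type*} (f : A → B) (x : A →₀ ℤ) (b : B) (s : Finset A)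
    (hs : ∀ a, f a = b ↔ a ∈ s) : Finsupp.mapDomain f x b = ∑ a ∈ s, x a := by
  classical
  induction x using Finsupp.induction_linear with
  | zero => simp
  | add x y hx hy => simp [Finsupp.mapDomain_add, hx, hy, Finset.sum_add_distrib]
  | single a n =>
    rw [Finsupp.mapDomain_single, Finsupp.single_apply]
    simp [Finsupp.single_apply, hs]

lemma exists_halves_of_valency_two {v : Γ.V} (hv : Γ.valency v = 2) :
    ∃ h₁ h₂ : Γ.H, h₁ ≠ h₂ ∧ ∀ h, Γ.vert h = v ↔ h = h₁ ∨ h = h₂ := by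
  obtain ⟨a, b, hab, H⟩ := Nat.card_eq_two_iff.1 hv
  refine ⟨a.1, b.1, fun h => hab (Subtype.ext h), fun h => ⟨fun hh => ?_, ?_⟩⟩
  · have : (⟨h, hh⟩ : {h : Γ.H // Γ.vert h = v}) ∈ ({a, b} : Set _) := H ▸ Set.mem_univ _
    rcases this with h' | h'
    · exact Or.inl (congrArg Subtype.val h')
    · exact Or.inr (congrArg Subtype.val h')
  · rintro (rfl | rfl)
    · exact a.2
    · exact b.2

/-- At a vertex of valency two, the two values of a flow cancel. -/
lemma flow_add_flow_eq_zero {o : Γ.Orientation} {c : Γ.E →₀ ℤ} (hc : c ∈ H1 o) {h₁ h₂ : Γ.H}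
    (hne : h₁ ≠ h₂) (hv : Γ.vert h₁ = Γ.vert h₂) (h2 : Γ.valency (Γ.vert h₁) = 2) :
    flow o c h₁ + flow o c h₂ = 0 := by
  classical
  obtain ⟨a, b, hab, H⟩ := exists_halves_of_valency_two h2
  have e1 := (H h₁).1 rfl
  have e2 := (H h₂).1 hv.symm
  have H' : ∀ h, Γ.vert h = Γ.vert h₁ ↔ h ∈ ({h₁, h₂} : Finset Γ.H) := by
    intro h
    rw [H, Finset.mem_insert, Finset.mem_singleton]
    grind
  have := mapDomain_apply_eq_sum Γ.vert (flow o c) (Γ.vert h₁) _ H'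
  rw [mem_H1_iff.1 hc, Finset.sum_pair hne] at this
  simpa using this.symm

lemma abs_flow (o : Γ.Orientation) (c : Γ.E →₀ ℤ) (h : Γ.H) : |flow o c h| = |c (Γ.edge h)| := by
  rw [flow_apply, abs_mul]
  rcases Int.units_eq_one_or (o.sgn h) with h | h <;> simp [h]

lemma IsCycle.abs_eq (hΓ : Γ.IsCycle) {o : Γ.Orientation} {c : Γ.E →₀ ℤ} (hc : c ∈ H1 o)
    (e e' : Γ.E) : |c e| = |c e'| := by
  obtain ⟨hconn, -, -, -, -, hval⟩ := hΓ
  have key : ∀ h₁ h₂, Γ.vert h₁ = Γ.vert h₂ → |c (Γ.edge h₁)| = |c (Γ.edge h₂)| := by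
    intro h₁ h₂ hv
    by_cases hne : h₁ = h₂
    · rw [hne]
    have := flow_add_flow_eq_zero hc hne hv (hval _)
    rw [← abs_flow o, ← abs_flow o, eq_neg_of_add_eq_zero_left this, abs_neg]
  have hex : ∀ v, ∃ h, Γ.vert h = v := fun v => by
    obtain ⟨a, _, _, H⟩ := exists_halves_of_valency_two (hval v)
    exact ⟨a, (H a).2 (Or.inl rfl)⟩
  choose f hf using hex
  have := hconn.eq_of_edge (fun v => |c (Γ.edge (f v))|) (by
    intro h h' he
    rw [key _ h (hf _), key _ h' (hf _), he]) (Γ.vert (o.tgt e)) (Γ.vert (o.tgt e'))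
  rwa [key _ (o.tgt e) (hf _), key _ (o.tgt e') (hf _), o.edge_tgt, o.edge_tgt] at this

/-- An orientation identifies the half-edges with two copies of the edges. -/
lemma halfEquiv (o : Γ.Orientation) : Nonempty (Γ.E × Bool ≃ Γ.H) := by
  refine ⟨Equiv.ofBijective (fun p => if p.2 then o.tgt p.1 else o.src p.1) ⟨?_, ?_⟩⟩
  · have he : ∀ p : Γ.E × Bool, Γ.edge (if p.2 then o.tgt p.1 else o.src p.1) = p.1 := by
      rintro ⟨e, _ | _⟩
      · simp [o.edge_src]
      · simp [o.edge_tgt]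
    rintro ⟨e, b⟩ ⟨e', b'⟩ h
    obtain rfl : e = e' := by
      have := congrArg Γ.edge h
      rwa [he, he] at this
    cases b <;> cases b'
    · rfl
    · exact absurd (by simpa using h) (o.src_ne_tgt e)
    · exact absurd (by simpa using h.symm) (o.src_ne_tgt e)
    · rfl
  · intro h
    rcases o.tgt_or_src h with h' | h'
    · exact ⟨(Γ.edge h, true), by simpa using h'⟩
    · exact ⟨(Γ.edge h, false), by simpa using h'⟩

lemma finite_H [Finite Γ.E] : Finite Γ.H := by
  obtain ⟨i⟩ := halfEquiv (Classical.arbitrary Γ.Orientation)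
  exact Finite.of_equiv _ i

lemma sum_valency [Finite Γ.E] [Fintype Γ.V] : ∑ v, Γ.valency v = 2 * Nat.card Γ.E := by
  have := Γ.finite_H
  obtain ⟨i⟩ := halfEquiv (Classical.arbitrary Γ.Orientation)
  have h1 := Nat.card_congr i
  rw [Nat.card_prod, Nat.card_congr (Equiv.sigmaFiberEquiv Γ.vert).symm, Nat.card_sigma,
    Nat.card_eq_fintype_card (α := Bool), Fintype.card_bool] at h1
  rw [mul_comm, h1]
  rfl

/-- Half of Euler's formula: the cycle space of a nonempty graph has rank at least `#E - #V + 1`. -/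
lemma euler_le [Finite Γ.E] [Finite Γ.V] [Nonempty Γ.V] (o : Γ.Orientation) :
    Nat.card Γ.E + 1 ≤
      Nat.card Γ.V + Module.finrank ℤ (LinearMap.ker (boundary o).toIntLinearMap) := by
  have := Fintype.ofFinite Γ.E
  have := Fintype.ofFinite Γ.V
  let L := (boundary o).toIntLinearMap
  let s : (Γ.V →₀ ℤ) →ₗ[ℤ] ℤ := Finsupp.linearCombination ℤ (fun _ => (1 : ℤ))
  have hs : Function.Surjective s := fun n =>
    ⟨Finsupp.single (Classical.arbitrary _) n, by simp [s]⟩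
  have hsL : LinearMap.range L ≤ LinearMap.ker s := by
    rintro _ ⟨c, rfl⟩
    rw [LinearMap.mem_ker]
    change s (boundary o c) = 0
    induction c using Finsupp.induction_linear with
    | zero => simp
    | add f g hf hg => rw [map_add, map_add, hf, hg, add_zero]
    | single e n => rw [boundary_single]; simp [s]
  have h1 := Submodule.finrank_quotient_add_finrank (LinearMap.ker L)
  have h2 := Submodule.finrank_quotient_add_finrank (LinearMap.ker s)
  rw [(LinearMap.quotKerEquivRange L).finrank_eq, Module.finrank_finsupp_self,
    ← Nat.card_eq_fintype_card] at h1
  rw [(LinearMap.quotKerEquivOfSurjective s hs).finrank_eq, Module.finrank_finsupp_self,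
    ← Nat.card_eq_fintype_card, Module.finrank_self] at h2
  have h3 := Submodule.finrank_mono hsL
  change _ ≤ _ + Module.finrank ℤ (LinearMap.ker L)
  omega

lemma IsCycle.exists_ne_zero (hΓ : Γ.IsCycle) (o : Γ.Orientation) : ∃ c ∈ H1 o, c ≠ 0 := by
  obtain ⟨-, n, hn, hE, hV, -⟩ := hΓ
  have : Finite Γ.E := Nat.finite_of_card_ne_zero (by omega)
  have : Finite Γ.V := Nat.finite_of_card_ne_zero (by omega)
  have : Nonempty Γ.V := (Nat.card_pos_iff.1 (by omega)).1
  have h := euler_le o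
  have hne : LinearMap.ker (boundary o).toIntLinearMap ≠ ⊥ := by
    intro h0
    rw [h0, finrank_bot] at h
    omega
  obtain ⟨c, hc, hc0⟩ := Submodule.exists_mem_ne_zero_of_ne_bot hne
  exact ⟨c, hc, hc0⟩

/-- A finite connected graph with nonzero first homology, in which no nonzero cycle class vanishes
on an edge, is a cycle: all valencies are at least two, and Euler's formula bounds their sum. -/
lemma isCycle_of_full_support [Finite Γ.E] [Finite Γ.V] (hconn : Γ.IsConnected)
    {o : Γ.Orientation} {c₀ : Γ.E →₀ ℤ} (hc₀ : c₀ ∈ H1 o) (h0 : c₀ ≠ 0)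
    (hfull : ∀ c ∈ H1 o, c ≠ 0 → ∀ e, c e ≠ 0) : Γ.IsCycle := by
  classical
  have := Fintype.ofFinite Γ.V
  have := Γ.finite_H
  obtain ⟨e₀, -⟩ := Finsupp.ne_iff.1 h0
  have : Nonempty Γ.V := ⟨Γ.vert (o.tgt e₀)⟩
  have hval2 : ∀ v, 2 ≤ Γ.valency v := by
    intro v
    have hv0 : Γ.valency v ≠ 0 := by
      intro hv
      have hno : ∀ h, Γ.vert h ≠ v := by
        intro h hh
        rcases Finite.card_eq_zero_iff.1 hv with ⟨H⟩
        exact H ⟨h, hh⟩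
      have := hconn.eq_of_edge (fun w => w = v) (by
        intro h h' _
        simp [hno]) v (Γ.vert (o.tgt e₀))
      simp [hno] at this
    have hv1 : Γ.valency v ≠ 1 := by
      intro hv
      obtain ⟨hs, ⟨a⟩⟩ := Nat.card_eq_one_iff_unique.1 hv
      have H : ∀ h, Γ.vert h = v ↔ h ∈ ({a.1} : Finset Γ.H) := by
        intro h
        rw [Finset.mem_singleton]
        constructor
        · intro hh
          exact congrArg Subtype.val (hs.elim ⟨h, hh⟩ a)
        · rintro rfl; exact a.2
      have hsum := mapDomain_apply_eq_sum Γ.vert (flow o c₀) v _ H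
      rw [mem_H1_iff.1 hc₀, Finset.sum_singleton, flow_apply] at hsum
      have := hfull c₀ hc₀ h0 (Γ.edge a.1)
      simp [this] at hsum
    omega
  have hker : Module.finrank ℤ (LinearMap.ker (boundary o).toIntLinearMap) ≤ 1 := by
    rw [← Module.finrank_self ℤ]
    refine LinearMap.finrank_le_finrank_of_injective
      (f := (Finsupp.lapply e₀).comp (LinearMap.ker (boundary o).toIntLinearMap).subtype) ?_
    rw [injective_iff_map_eq_zero]
    rintro ⟨c, hc⟩ hce
    by_contra hne
    exact hfull c hc (fun h => hne (Subtype.ext h)) e₀ hce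
  have heul := euler_le o
  have hsum := Γ.sum_valency
  have hconst : ∑ _v : Γ.V, 2 = 2 * Nat.card Γ.V := by
    simp [mul_comm]
  have hle : ∑ _v : Γ.V, 2 ≤ ∑ v : Γ.V, Γ.valency v := Finset.sum_le_sum fun v _ => hval2 v
  have hEV : Nat.card Γ.E = Nat.card Γ.V := by omega
  refine ⟨hconn, Nat.card Γ.E, ?_, rfl, hEV.symm, fun v => ?_⟩
  · have : Nonempty Γ.E := ⟨e₀⟩
    exact Nat.card_pos
  · have heq : ∑ _v : Γ.V, 2 = ∑ v : Γ.V, Γ.valency v := by omega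
    exact ((Finset.sum_eq_sum_iff_of_le fun v _ => hval2 v).1 heq v (Finset.mem_univ v)).symm

/-- The cycles of a finite graph are the minimal nonempty supports of its cycle classes. -/
lemma isCycleIn_iff [Finite Γ.E] (o : Γ.Orientation) (Z : Set Γ.E) :
    Γ.IsCycleIn Z ↔ (∃ c ∈ H1 o, c ≠ 0 ∧ ∀ e ∉ Z, c e = 0) ∧
      ∀ c ∈ H1 o, c ≠ 0 → (∀ e ∉ Z, c e = 0) → ∀ e ∈ Z, c e ≠ 0 := by
  have hH := Γ.finite_H
  have hinj := Finsupp.mapDomain_injective (M := ℤ) (spannedEdge Z).injective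
  constructor
  · intro hZ
    refine ⟨?_, ?_⟩
    · obtain ⟨d, hd, hd0⟩ := IsCycle.exists_ne_zero hZ (o.spanned Z)
      refine ⟨ext (spannedEdge Z) d, mem_H1_spanned.1 hd, fun h => hd0 (hinj ?_), fun e he => ?_⟩
      · exact h.trans Finsupp.mapDomain_zero.symm
      · exact ext_apply_notMem _ _ (by simpa using he)
    · intro c hc hc0 hcZ e he hce
      have hext := ext_res (spannedEdge Z) (c := c) (by simpa using hcZ)
      have hd : res (spannedEdge Z) c ∈ H1 (o.spanned Z) := by rw [mem_H1_spanned, hext]; exact hc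
      apply hc0
      ext e'
      by_cases he' : e' ∈ Z
      · have := IsCycle.abs_eq hZ hd ⟨e', he'⟩ ⟨e, he⟩
        change |c e'| = |c e| at this
        rw [hce] at this
        simpa using this
      · exact hcZ e' he'
  · rintro ⟨⟨c, hc, hc0, hcZ⟩, hmin⟩
    have hext := ext_res (spannedEdge Z) (c := c) (by simpa using hcZ)
    have hd : res (spannedEdge Z) c ∈ H1 (o.spanned Z) := by rw [mem_H1_spanned, hext]; exact hc
    have hd0 : res (spannedEdge Z) c ≠ 0 := by
      intro h; apply hc0; rw [← hext, h]; exact Finsupp.mapDomain_zero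
    have hfull : ∀ d ∈ H1 (o.spanned Z), d ≠ 0 → ∀ e, d e ≠ 0 := by
      intro d hd hd0 e
      rw [← ext_apply (spannedEdge Z) d e]
      refine hmin _ (mem_H1_spanned.1 hd) (fun h => hd0 (hinj ?_)) (fun e' he' => ?_) _ e.2
      · exact h.trans Finsupp.mapDomain_zero.symm
      · exact ext_apply_notMem _ _ (by simpa using he')
    have : Finite (Γ.spanned Z).E := Finite.of_injective _ (spannedEdge Z).injective
    have := (Γ.spanned Z).finite_H
    have hsurj : Function.Surjective (Γ.spanned Z).vert := by
      rintro ⟨v, h, hh, rfl⟩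
      exact ⟨⟨h, hh⟩, rfl⟩
    have : Finite (Γ.spanned Z).V := Finite.of_surjective _ hsurj
    obtain ⟨e₀, he₀⟩ := Finsupp.ne_iff.1 hd0
    refine isCycle_of_full_support (o := o.spanned Z) ⟨⟨edgeComp (o.spanned Z) e₀⟩, ⟨?_⟩⟩
      hd hd0 hfull
    -- Two different components would allow a cycle class to be cut off along one of them.
    rintro ⟨v⟩ ⟨w⟩
    obtain ⟨h, rfl⟩ := hsurj v
    obtain ⟨h', rfl⟩ := hsurj w
    change comp _ = comp _
    classical
    by_contra hne
    have hw := weight_mem_H1 hd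
      (fun K => if K = comp ((Γ.spanned Z).vert h) then 1 else 0)
    refine hfull _ hw ?_ ((Γ.spanned Z).edge h') ?_
    · refine Finsupp.ne_iff.2 ⟨(Γ.spanned Z).edge h, ?_⟩
      rw [Finsupp.coe_pointwise_smul, Pi.smul_apply', edgeComp_edge, if_pos rfl]
      simpa using hfull _ hd hd0 _
    · rw [Finsupp.coe_pointwise_smul, Pi.smul_apply', edgeComp_edge,
        if_neg (Ne.symm hne), zero_smul]

/-! ### Separating edges -/

/-- The connected component of `Γ ∖ S` containing a vertex of `Γ`. -/
def delComp (S : Set Γ.E) (v : Γ.V) : (Γ.delete S).Components := comp (Γ := Γ.delete S) v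

/-- The map on components induced by the inclusion of `Γ ∖ S` in `Γ`. -/
def deleteComp (S : Set Γ.E) : (Γ.delete S).Components → Γ.Components :=
  Quot.lift (fun v : Γ.V => comp v) (by
    rintro _ _ ⟨h, h', -, he, rfl, rfl⟩
    exact comp_vert_eq (congrArg Subtype.val he))

lemma deleteComp_comp (S : Set Γ.E) (v : Γ.V) :
    deleteComp S (delComp S v) = comp v := rfl

lemma deleteComp_surjective (S : Set Γ.E) : Function.Surjective (deleteComp S) := by
  rintro ⟨v⟩
  exact ⟨delComp S v, rfl⟩

lemma comp_delete_eq {S : Set Γ.E} {h h' : Γ.H} (he : Γ.edge h = Γ.edge h') (hS : Γ.edge h ∉ S) :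
    delComp S (Γ.vert h) = delComp S (Γ.vert h') :=
  comp_vert_eq (Γ := Γ.delete S) (h := ⟨h, hS⟩) (h' := ⟨h', he ▸ hS⟩) (Subtype.ext he)

lemma not_isSeparating_of_mem_H1 {o : Γ.Orientation} {c : Γ.E →₀ ℤ} (hc : c ∈ H1 o) {e : Γ.E}
    (hce : c e ≠ 0) : ¬ Γ.IsSeparating e := by
  have hends : delComp {e} (Γ.vert (o.tgt e)) =
      delComp {e} (Γ.vert (o.src e)) := by
    have h := res_mem_H1_contract {e} hc
    let e' : (Γ.contract {e}).E := ⟨e, rfl⟩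
    have hs : res (contractEdge {e}) c = Finsupp.single e' (c e) := by
      ext f
      obtain rfl : f = e' := Subtype.ext f.2
      rw [Finsupp.single_eq_same]
      rfl
    rw [hs, mem_H1, boundary_single, sub_eq_zero] at h
    by_contra hne
    have h1 := DFunLike.congr_fun h ((Γ.contract {e}).vert ((o.contract {e}).tgt e'))
    rw [Finsupp.single_eq_same, Finsupp.single_eq_of_ne] at h1
    · exact hce h1
    · exact hne
  have hinj : Function.Injective (deleteComp {e}) := by
    have key : ∀ v w, Γ.Adj v w → delComp {e} v = delComp {e} w := by
      rintro _ _ ⟨h, h', hne, he, rfl, rfl⟩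
      by_cases hh : Γ.edge h = e
      · rcases o.tgt_or_src h with h1 | h1 <;> rcases o.tgt_or_src h' with h2 | h2 <;>
          rw [← he] at h2
        · exact absurd (h1.symm.trans h2) hne
        · rw [← h1, ← h2, hh]; exact hends
        · rw [← h1, ← h2, hh]; exact hends.symm
        · exact absurd (h1.symm.trans h2) hne
      · exact comp_delete_eq he hh
    have hleft : Function.LeftInverse (Quot.lift (delComp {e}) key :
        Γ.Components → _) (deleteComp {e}) := by
      rintro ⟨v⟩
      rfl
    exact hleft.injective
  exact not_lt.2 (ENat.card_le_card_of_injective hinj)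

/-- The two ends of a non-separating edge can be joined without using this edge. -/
lemma exists_mem_H1_of_not_isSeparating [Finite Γ.V] (o : Γ.Orientation) {e : Γ.E}
    (he : ¬ Γ.IsSeparating e) : ∃ c ∈ H1 o, c e ≠ 0 := by
  have : Finite (Γ.delete {e}).Components :=
    Finite.of_surjective (delComp {e}) Quot.mk_surjective
  have : Finite Γ.Components := Finite.of_surjective _ (deleteComp_surjective {e})
  have hle := not_lt.1 he
  rw [ENat.card_eq_coe_natCard, ENat.card_eq_coe_natCard, Nat.cast_le] at hle
  have hbij := (deleteComp_surjective {e}).bijective_of_nat_card_le hle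
  have hends : delComp {e} (Γ.vert (o.tgt e)) =
      delComp {e} (Γ.vert (o.src e)) := by
    apply hbij.1
    rw [deleteComp_comp, deleteComp_comp]
    exact comp_vert_eq ((o.edge_tgt e).trans (o.edge_src e).symm)
  obtain ⟨d, hd⟩ := exists_boundary_eq (o.delete {e}) (boundary o (Finsupp.single e 1)) (by
    have := (Finsupp.mapDomain.addMonoidHom (M := ℤ) (delComp {e})).map_sub
      (Finsupp.single (Γ.vert (o.tgt e)) 1) (Finsupp.single (Γ.vert (o.src e)) 1)
    rw [boundary_single]
    refine this.trans ?_
    simp only [Finsupp.mapDomain.addMonoidHom_apply]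
    rw [sub_eq_zero]
    refine Finsupp.mapDomain_single.trans (Eq.trans ?_ Finsupp.mapDomain_single.symm)
    rw [hends])
  rw [boundary_delete] at hd
  refine ⟨Finsupp.single e 1 - ext (deleteEdge {e}) d, ?_, ?_⟩
  · rw [mem_H1, map_sub, sub_eq_zero]; exact hd.symm
  · rw [Finsupp.sub_apply, ext_apply_notMem _ _ (by simp)]
    simp

/-! ### Coupled edges and C1-sets -/

/-- Two edges are coupled if every cycle class that vanishes on one of them vanishes on the other.
-/
def Coupled (o : Γ.Orientation) (e f : Γ.E) : Prop := ∀ c ∈ H1 o, c e = 0 ↔ c f = 0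

lemma Coupled.refl (o : Γ.Orientation) (e : Γ.E) : Coupled o e e := fun _ _ => Iff.rfl

lemma Coupled.symm {o : Γ.Orientation} {e f : Γ.E} (h : Coupled o e f) : Coupled o f e :=
  fun c hc => (h c hc).symm

lemma Coupled.trans {o : Γ.Orientation} {e f g : Γ.E} (h : Coupled o e f) (h' : Coupled o f g) :
    Coupled o e g := fun c hc => (h c hc).trans (h' c hc)

/-- The class of an edge with respect to coupling. -/
def coupledClass (o : Γ.Orientation) (e : Γ.E) : Set Γ.E := {f | Coupled o e f}

lemma mem_coupledClass {o : Γ.Orientation} {e f : Γ.E} : f ∈ coupledClass o e ↔ Coupled o e f :=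
  Iff.rfl

lemma res_mem_H1_delete {o : Γ.Orientation} {S : Set Γ.E} {c : Γ.E →₀ ℤ} (hc : c ∈ H1 o)
    (h0 : ∀ e ∈ S, c e = 0) : res (deleteEdge S) c ∈ H1 (o.delete S) := by
  rw [mem_H1_delete, ext_res]
  · exact hc
  · simpa using h0

instance [Finite Γ.V] (S : Set Γ.E) : Finite (Γ.delete S).V := inferInstanceAs (Finite Γ.V)

instance [Finite Γ.E] (S : Set Γ.E) : Finite (Γ.contract S).E :=
  Finite.of_injective _ (contractEdge S).injective

instance [Finite Γ.V] (S : Set Γ.E) : Finite (Γ.contract S).V :=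
  Finite.of_surjective (delComp S) Quot.mk_surjective

lemma IsC1Set.eq_coupledClass [Finite Γ.V] (o : Γ.Orientation) {S : Set Γ.E} (hS : Γ.IsC1Set S)
    {e : Γ.E} (he : e ∈ S) : S = coupledClass o e := by
  ext f
  constructor
  · intro hf c hc
    have := hS.2.abs_eq (res_mem_H1_contract S hc) ⟨e, he⟩ ⟨f, hf⟩
    change |c e| = |c f| at this
    rw [← abs_eq_zero, this, abs_eq_zero]
  · intro hf
    by_contra hfS
    obtain ⟨d, hd, hdf⟩ := exists_mem_H1_of_not_isSeparating (o.delete S) (hS.1 ⟨f, hfS⟩)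
    rw [mem_H1_delete] at hd
    have h1 := (hf _ hd).1 (ext_apply_notMem _ _ (by simpa using he))
    exact hdf ((ext_apply (deleteEdge S) d ⟨f, hfS⟩).symm.trans h1)

lemma IsC1Set.nonempty {S : Set Γ.E} (hS : Γ.IsC1Set S) : S.Nonempty := by
  obtain ⟨-, n, hn, hE, -⟩ := hS.2
  obtain ⟨e⟩ := (Nat.card_pos_iff.1 (show 0 < Nat.card (Γ.contract S).E by omega)).1
  exact ⟨e.1, e.2⟩

lemma IsConnected.contract (hconn : Γ.IsConnected) (S : Set Γ.E) : (Γ.contract S).IsConnected := by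
  constructor
  · obtain ⟨⟨v⟩⟩ := hconn.1
    exact ⟨comp (Γ := Γ.contract S) (delComp S v)⟩
  · constructor
    rintro ⟨⟨v⟩⟩ ⟨⟨w⟩⟩
    refine hconn.eq_of_edge
      (fun v => comp (Γ := Γ.contract S) (delComp S v)) (fun h h' he => ?_) v w
    by_cases hh : Γ.edge h ∈ S
    · exact comp_vert_eq (Γ := Γ.contract S) (h := ⟨h, hh⟩) (h' := ⟨h', he ▸ hh⟩) (Subtype.ext he)
    · exact congrArg _ (comp_delete_eq he hh)

/-- In a connected graph without separating edges the classes of coupled edges are C1-sets. -/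
lemma isC1Set_coupledClass [Finite Γ.E] [Finite Γ.V] (hconn : Γ.IsConnected)
    (hbr : ∀ e, ¬ Γ.IsSeparating e) (o : Γ.Orientation) (e : Γ.E) :
    Γ.IsC1Set (coupledClass o e) := by
  obtain ⟨c₀, hc₀, h0⟩ := exists_mem_H1_of_not_isSeparating o (hbr e)
  constructor
  · -- An edge outside the class lies on a cycle class vanishing at `e`, hence on the whole class.
    rintro ⟨f, hf⟩
    obtain ⟨c, hc, hcf, hce⟩ : ∃ c ∈ H1 o, c f ≠ 0 ∧ c e = 0 := by
      rw [mem_coupledClass, Coupled] at hf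
      push Not at hf
      obtain ⟨c, hc, h⟩ := hf
      rcases h with ⟨h1, h2⟩ | ⟨h1, h2⟩
      · exact ⟨c, hc, h2, h1⟩
      · obtain ⟨d, hd, hdf⟩ := exists_mem_H1_of_not_isSeparating o (hbr f)
        refine ⟨c e • d - d e • c, sub_mem (zsmul_mem hd _) (zsmul_mem hc _), ?_, ?_⟩
        · simp [h2, hdf, h1]
        · simp [mul_comm]
    refine not_isSeparating_of_mem_H1
      (res_mem_H1_delete (S := coupledClass o e) hc fun g hg => (hg c hc).1 hce) hcf
  · refine isCycle_of_full_support (hconn.contract _)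
      (res_mem_H1_contract (coupledClass o e) hc₀) ?_ ?_
    · exact Finsupp.ne_iff.2 ⟨⟨e, Coupled.refl o e⟩, h0⟩
    · intro d hd hd0 f hdf
      obtain ⟨c, hc, hcd⟩ := exists_mem_H1_res_eq hd
      obtain ⟨g, hg⟩ := Finsupp.ne_iff.1 hd0
      rw [← hcd] at hdf hg
      exact hg ((g.2 c hc).1 ((f.2 c hc).2 hdf))

/-- Coupled edges lie in the same component after removal of a C1-set not containing them. -/
lemma IsC1Set.comp_delete_eq_of_coupled [Finite Γ.V] {o : Γ.Orientation} {S : Set Γ.E}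
    (hS : Γ.IsC1Set S) {h h' : Γ.H} (hc : Coupled o (Γ.edge h) (Γ.edge h')) (hh : Γ.edge h ∉ S)
    (hh' : Γ.edge h' ∉ S) :
    delComp S (Γ.vert h) = delComp S (Γ.vert h') := by
  classical
  by_contra hne
  let e : (Γ.delete S).E := ⟨Γ.edge h, hh⟩
  let e' : (Γ.delete S).E := ⟨Γ.edge h', hh'⟩
  obtain ⟨d, hd, hdf⟩ := exists_mem_H1_of_not_isSeparating (o.delete S) (hS.1 e)
  have hK : edgeComp (o.delete S) e = delComp S (Γ.vert h) :=
    edgeComp_edge (o.delete S) (⟨h, hh⟩ : (Γ.delete S).H)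
  have hK' : edgeComp (o.delete S) e' = delComp S (Γ.vert h') :=
    edgeComp_edge (o.delete S) (⟨h', hh'⟩ : (Γ.delete S).H)
  obtain ⟨g, hg1, hg2⟩ : ∃ g : (Γ.delete S).Components → ℤ,
      g (edgeComp (o.delete S) e) = 1 ∧ g (edgeComp (o.delete S) e') = 0 :=
    ⟨fun K => if K = delComp S (Γ.vert h) then 1 else 0, by rw [hK]; exact if_pos rfl,
      by rw [hK']; exact if_neg (Ne.symm hne)⟩
  have hw := weight_mem_H1 hd g
  rw [mem_H1_delete] at hw
  have h1 := ext_apply (deleteEdge S) ((fun e => g (edgeComp (o.delete S) e)) • d) e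
  have h2 := ext_apply (deleteEdge S) ((fun e => g (edgeComp (o.delete S) e)) • d) e'
  rw [Finsupp.coe_pointwise_smul, Pi.smul_apply', hg1, one_smul] at h1
  rw [Finsupp.coe_pointwise_smul, Pi.smul_apply', hg2, zero_smul] at h2
  exact hdf (h1.symm.trans ((hc _ hw).2 h2))

/-! ### Cyclic orientations of C1-sets -/

lemma sgn_contract (o : Γ.Orientation) (S : Set Γ.E) (h : (Γ.contract S).H) :
    (o.contract S).sgn h = o.sgn h.1 := by
  unfold Orientation.sgn
  congr 1
  exact propext Subtype.ext_iff

lemma flow_opp (o : Γ.Orientation) (c : Γ.E →₀ ℤ) {h h' : Γ.H} (hne : h ≠ h')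
    (he : Γ.edge h = Γ.edge h') : flow o c h' = - flow o c h := by
  rw [flow_apply, flow_apply, o.sgn_opp hne he, he]
  simp

/-- A C1-set has an orientation, given by signs on its half-edges, in which it is run through as
a cycle; every flow is a multiple of it. -/
lemma IsC1Set.exists_cyclic_signs [Finite Γ.V] (o : Γ.Orientation) {S : Set Γ.E}
    (hS : Γ.IsC1Set S) : ∃ σ : Γ.H → ℤˣ,
      (∀ h h', h ≠ h' → Γ.edge h ∈ S → Γ.edge h = Γ.edge h' → σ h' = - σ h) ∧
      (∀ h h', h ≠ h' → Γ.edge h ∈ S → Γ.edge h' ∈ S →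
        delComp S (Γ.vert h) = delComp S (Γ.vert h') →
        σ h' = - σ h) ∧
      ∀ c ∈ H1 o, ∃ n : ℤ, ∀ h, Γ.edge h ∈ S → flow o c h = n * σ h := by
  classical
  obtain ⟨d, hd, hd0⟩ := hS.2.exists_ne_zero (o.contract S)
  obtain ⟨e₀, he₀⟩ := Finsupp.ne_iff.1 hd0
  rw [Finsupp.zero_apply] at he₀
  obtain ⟨c, hc, hcd⟩ := exists_mem_H1_res_eq hd
  obtain ⟨m, hm⟩ : ∃ m, |d e₀| = m := ⟨_, rfl⟩
  have hm0 : 0 < m := hm ▸ abs_pos.2 he₀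
  have habs : ∀ h, Γ.edge h ∈ S → |flow o c h| = m := by
    intro h hh
    rw [abs_flow, ← hm, ← hS.2.abs_eq hd ⟨Γ.edge h, hh⟩ e₀]
    exact congrArg _ (hcd ⟨Γ.edge h, hh⟩)
  let σ : Γ.H → ℤˣ := fun h => if 0 < flow o c h then 1 else -1
  have hσ : ∀ h, Γ.edge h ∈ S → flow o c h = m * σ h := by
    intro h hh
    have := habs h hh
    simp only [σ]
    split_ifs with h1
    · rw [abs_of_pos h1] at this; simpa using this
    · rw [abs_of_nonpos (not_lt.1 h1)] at this
      simp only [Units.val_neg, Units.val_one, mul_neg, mul_one]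
      omega
  have hopp : ∀ h h', Γ.edge h ∈ S → Γ.edge h' ∈ S → flow o c h' = - flow o c h →
      σ h' = - σ h := by
    intro h h' hh hh' H
    rw [hσ h hh, hσ h' hh', ← mul_neg] at H
    exact Units.ext (by simpa using mul_left_cancel₀ hm0.ne' H)
  refine ⟨σ, fun h h' hne hh he => ?_, fun h h' hne hh hh' hK => ?_, fun c' hc' => ?_⟩
  · exact hopp h h' hh (he ▸ hh) (flow_opp o c hne he)
  · refine hopp h h' hh hh' ?_
    have := flow_add_flow_eq_zero hd (h₁ := ⟨h, hh⟩) (h₂ := ⟨h', hh'⟩)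
      (fun H => hne (congrArg Subtype.val H)) hK (hS.2.2.choose_spec.2.2.2 _)
    have hf : ∀ x : (Γ.contract S).H, flow (o.contract S) d x = flow o c x.1 := by
      intro x
      rw [flow_apply, flow_apply, sgn_contract, ← hcd]
      rfl
    exact eq_neg_of_add_eq_zero_right
      ((congrArg₂ (· + ·) (hf ⟨h, hh⟩) (hf ⟨h', hh'⟩)).symm.trans this)
  · -- This combination vanishes at `e₀`, hence on all of `S`, so `c'` is proportional to `c` there.
    have hx : c e₀.1 • c' - c' e₀.1 • c ∈ H1 o := sub_mem (zsmul_mem hc' _) (zsmul_mem hc _)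
    obtain ⟨h₀, hh₀⟩ : ∃ h, Γ.edge h = e₀.1 := ⟨_, o.edge_tgt _⟩
    have hS₀ : Γ.edge h₀ ∈ S := hh₀ ▸ e₀.2
    refine ⟨o.sgn h₀ * σ h₀ * c' e₀.1, fun h hh => ?_⟩
    have hcoup : Coupled o e₀.1 (Γ.edge h) := by
      have := hS.eq_coupledClass o e₀.2
      rw [this] at hh
      exact hh
    have h1 := (hcoup _ hx).1 (by simp [mul_comm])
    simp only [Finsupp.sub_apply, Finsupp.smul_apply, smul_eq_mul, sub_eq_zero] at h1
    have h2 := hσ h hh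
    have h3 := hσ h₀ hS₀
    rw [flow_apply] at h2 h3
    rw [hh₀] at h3
    rw [flow_apply]
    have hs0 := Int.units_coe_mul_self (o.sgn h₀)
    have ht0 := Int.units_coe_mul_self (σ h₀)
    have h4 : c e₀.1 = m * σ h₀ * o.sgn h₀ := by
      linear_combination (c e₀.1) * (-hs0) + (o.sgn h₀ : ℤ) * h3
    rw [h4] at h1
    apply mul_left_cancel₀ hm0.ne'
    linear_combination (o.sgn h₀ * σ h₀ * o.sgn h : ℤ) * h1 + (o.sgn h₀ * σ h₀ * c' e₀.1 : ℤ) * h2 -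
      (m * o.sgn h * c' (Γ.edge h)) * (σ h₀ * σ h₀ * hs0 + ht0)

/-- A chain can be rewritten with respect to another orientation without changing its flow. -/
lemma exists_flow_eq (o o' : Γ.Orientation) (c : Γ.E →₀ ℤ) : ∃ c', flow o c' = flow o' c := by
  have ht : Function.Injective o.tgt := fun a b h => by rw [← o.edge_tgt a, h, o.edge_tgt]
  refine ⟨Finsupp.comapDomain o.tgt (flow o' c) ht.injOn, ?_⟩
  ext h
  rw [flow_apply, Finsupp.comapDomain_apply]
  rcases o.tgt_or_src h with h1 | h1
  · rw [h1, ← h1, o.sgn_tgt]; simp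
  · rw [← h1, o.sgn_src, o.edge_src, flow_opp o' c (o.src_ne_tgt _)]
    · simp
    · rw [o.edge_tgt, o.edge_src]

/-- In a connected graph without separating edges, all C1-sets can be oriented cyclically at the
same time, since they partition the edges. -/
lemma exists_cyclic_signs [Finite Γ.E] [Finite Γ.V] (hconn : Γ.IsConnected)
    (hbr : ∀ e, ¬ Γ.IsSeparating e) : ∃ σ : Γ.H → ℤˣ,
      (∀ h h', h ≠ h' → Γ.edge h = Γ.edge h' → σ h' = - σ h) ∧
      (∀ S, Γ.IsC1Set S → ∀ h h', h ≠ h' → Γ.edge h ∈ S → Γ.edge h' ∈ S →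
        delComp S (Γ.vert h) = delComp S (Γ.vert h') → σ h' = - σ h) ∧
      ∀ (o : Γ.Orientation), ∀ c ∈ H1 o, ∀ S, Γ.IsC1Set S →
        ∃ n : ℤ, ∀ h, Γ.edge h ∈ S → flow o c h = n * σ h := by
  let o := Classical.arbitrary Γ.Orientation
  have hcls := isC1Set_coupledClass hconn hbr o
  choose σ h1 h2 h3 using fun S : {S // Γ.IsC1Set S} => S.2.exists_cyclic_signs o
  have hσ : ∀ S : {S // Γ.IsC1Set S}, ∀ h, Γ.edge h ∈ S.1 →
      σ ⟨_, hcls (Γ.edge h)⟩ h = σ S h := by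
    rintro ⟨S, hS⟩ h hh
    congr 2
    exact (hS.eq_coupledClass o hh).symm
  refine ⟨fun h => σ ⟨_, hcls (Γ.edge h)⟩ h, fun h h' hne he => ?_,
    fun S hS h h' hne hh hh' hK => ?_, fun o' c hc S hS => ?_⟩
  · have hh := Coupled.refl o (Γ.edge h)
    beta_reduce
    rw [← h1 ⟨_, hcls (Γ.edge h)⟩ h h' hne hh he, hσ ⟨_, hcls (Γ.edge h)⟩ h']
    exact he ▸ hh
  · beta_reduce
    rw [hσ ⟨S, hS⟩ h hh, hσ ⟨S, hS⟩ h' hh']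
    exact h2 ⟨S, hS⟩ h h' hne hh hh' hK
  · obtain ⟨c', hc'⟩ := exists_flow_eq o o' c
    obtain ⟨n, hn⟩ := h3 ⟨S, hS⟩ c' (by rw [mem_H1_iff, hc', ← mem_H1_iff]; exact hc)
    refine ⟨n, fun h hh => ?_⟩
    beta_reduce
    rw [hσ ⟨S, hS⟩ h hh, ← hc']
    exact hn h hh

variable {Γ' : HGraph.{u}}

/-! ### Bijections of edges that preserve the first homology -/

lemma chainEquiv_apply (ε : Γ.E ≃ Γ'.E) (c : Γ.E →₀ ℤ) (e : Γ.E) :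
    chainEquiv ε c (ε e) = c e := by
  simp [chainEquiv]

section PreservesH1

variable {ε : Γ.E ≃ Γ'.E} {o : Γ.Orientation} {o' : Γ'.Orientation}

lemma coupled_iff_of_H1 (hH : ∀ c, c ∈ H1 o ↔ chainEquiv ε c ∈ H1 o') (e f : Γ.E) :
    Coupled o' (ε e) (ε f) ↔ Coupled o e f := by
  constructor
  · intro h c hc
    simpa only [chainEquiv_apply] using h _ ((hH c).1 hc)
  · intro h c hc
    obtain ⟨c, rfl⟩ := (chainEquiv ε).surjective c
    simpa only [chainEquiv_apply] using h c ((hH c).2 hc)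

lemma image_coupledClass (hH : ∀ c, c ∈ H1 o ↔ chainEquiv ε c ∈ H1 o') (e : Γ.E) :
    ε '' coupledClass o e = coupledClass o' (ε e) := by
  ext f'
  obtain ⟨f, rfl⟩ := ε.surjective f'
  rw [ε.injective.mem_set_image, mem_coupledClass, mem_coupledClass, coupled_iff_of_H1 hH]

lemma isC1Set_iff_eq_coupledClass [Finite Γ.E] [Finite Γ.V] (hconn : Γ.IsConnected)
    (hbr : ∀ e, ¬ Γ.IsSeparating e) (o : Γ.Orientation) (S : Set Γ.E) :
    Γ.IsC1Set S ↔ ∃ e, S = coupledClass o e := by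
  constructor
  · intro hS
    obtain ⟨e, he⟩ := hS.nonempty
    exact ⟨e, hS.eq_coupledClass o he⟩
  · rintro ⟨e, rfl⟩
    exact isC1Set_coupledClass hconn hbr o e

lemma isC1Set_image_iff [Finite Γ.E] [Finite Γ.V] [Finite Γ'.E] [Finite Γ'.V]
    (hconn : Γ.IsConnected) (hbr : ∀ e, ¬ Γ.IsSeparating e)
    (hconn' : Γ'.IsConnected) (hbr' : ∀ e, ¬ Γ'.IsSeparating e)
    (hH : ∀ c, c ∈ H1 o ↔ chainEquiv ε c ∈ H1 o') (S : Set Γ.E) :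
    Γ.IsC1Set S ↔ Γ'.IsC1Set (ε '' S) := by
  rw [isC1Set_iff_eq_coupledClass hconn hbr o, isC1Set_iff_eq_coupledClass hconn' hbr' o',
    ε.surjective.exists (p := fun e' => ε '' S = coupledClass o' e')]
  refine exists_congr fun e => ?_
  rw [← image_coupledClass hH, ε.injective.image_injective.eq_iff]

lemma isCyclicBijection_of_H1 [Finite Γ.E] [Finite Γ'.E]
    (hH : ∀ c, c ∈ H1 o ↔ chainEquiv ε c ∈ H1 o') : IsCyclicBijection ε := by
  intro Z
  have hsupp : ∀ c : Γ.E →₀ ℤ, (∀ e ∉ Z, c e = 0) ↔ ∀ e' ∉ ε '' Z, chainEquiv ε c e' = 0 := by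
    intro c
    rw [ε.forall_congr_left]
    refine forall_congr' fun e' => ?_
    rw [← chainEquiv_apply ε c, ε.apply_symm_apply, ε.image_eq_preimage_symm]
    rfl
  rw [isCycleIn_iff o, isCycleIn_iff o']
  constructor
  · rintro ⟨⟨c, hc, hc0, hcZ⟩, hmin⟩
    refine ⟨⟨chainEquiv ε c, (hH c).1 hc, by simpa using hc0, (hsupp c).1 hcZ⟩, ?_⟩
    intro d' hd hd0 hdZ e' he'
    obtain ⟨d, rfl⟩ := (chainEquiv ε).surjective d'
    obtain ⟨e, he, rfl⟩ := he'
    rw [chainEquiv_apply]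
    exact hmin d ((hH d).2 hd) (by simpa using hd0) ((hsupp d).2 hdZ) e he
  · rintro ⟨⟨c', hc, hc0, hcZ⟩, hmin⟩
    obtain ⟨c, rfl⟩ := (chainEquiv ε).surjective c'
    refine ⟨⟨c, (hH c).2 hc, by simpa using hc0, (hsupp c).2 hcZ⟩, ?_⟩
    intro d hd hd0 hdZ e he
    rw [← chainEquiv_apply ε]
    exact hmin _ ((hH d).1 hd) (by simpa using hd0) ((hsupp d).1 hdZ) _ ⟨e, he, rfl⟩

end PreservesH1

/-! ### Regluing along C1-sets -/

lemma card_halves (S : Set Γ.E) :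
    Nat.card {h : Γ.H // Γ.edge h ∈ S} = 2 * Nat.card {e : Γ.E // e ∈ S} := by
  obtain ⟨i⟩ := halfEquiv (Classical.arbitrary (Γ.contract S).Orientation)
  have := Nat.card_congr i
  rw [Nat.card_prod, Nat.card_eq_fintype_card (α := Bool), Fintype.card_bool] at this
  exact this.symm.trans (mul_comm _ _)

/-- Two graphs with the same half-edges, vertices and C1-sets, but whose half-edges may be joined to
edges in different ways. -/
structure Regluing (Γ Γ' : HGraph.{u}) where
  /-- the bijection of the half-edges -/
  half : Γ.H ≃ Γ'.H
  /-- the bijection of the vertices -/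
  vertex : Γ.V ≃ Γ'.V
  vert_half : ∀ h, Γ'.vert (half h) = vertex (Γ.vert h)
  /-- the bijection of the C1-sets -/
  c1 : {S : Set Γ.E // Γ.IsC1Set S} ≃ {S : Set Γ'.E // Γ'.IsC1Set S}
  edge_half : ∀ S h, Γ'.edge (half h) ∈ (c1 S).1 ↔ Γ.edge h ∈ S.1

namespace Regluing

variable [Finite Γ.E] [Finite Γ.V] [Finite Γ'.V]

/-- Corresponding C1-sets have equally many edges, so the edges can be matched. -/
lemma exists_edge_equiv [Finite Γ'.E] (ρ : Regluing Γ Γ') (hconn : Γ.IsConnected)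
    (hbr : ∀ e, ¬ Γ.IsSeparating e) (hconn' : Γ'.IsConnected)
    (hbr' : ∀ e, ¬ Γ'.IsSeparating e) :
    ∃ ε : Γ.E ≃ Γ'.E, ∀ S e, ε e ∈ (ρ.c1 S).1 ↔ e ∈ S.1 := by
  let κ : Γ.E → {S : Set Γ.E // Γ.IsC1Set S} :=
    fun e => ⟨_, isC1Set_coupledClass hconn hbr (Classical.arbitrary _) e⟩
  let κ' : Γ'.E → {S : Set Γ'.E // Γ'.IsC1Set S} :=
    fun e => ⟨_, isC1Set_coupledClass hconn' hbr' (Classical.arbitrary _) e⟩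
  have hκ : ∀ S e, κ e = S ↔ e ∈ S.1 := fun S e =>
    ⟨fun h => h ▸ Coupled.refl _ e, fun h => Subtype.ext (S.2.eq_coupledClass _ h).symm⟩
  have hκ' : ∀ S e, κ' e = S ↔ e ∈ S.1 := fun S e =>
    ⟨fun h => h ▸ Coupled.refl _ e, fun h => Subtype.ext (S.2.eq_coupledClass _ h).symm⟩
  have hcard : ∀ S, Nonempty ({e // κ e = S} ≃ {e' // κ' e' = ρ.c1 S}) := by
    intro S
    simp only [hκ, hκ']
    refine Finite.card_eq.1 ?_
    have h1 := Nat.card_congr (ρ.half.subtypeEquiv (p := fun h => Γ.edge h ∈ S.1)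
      (q := fun h => Γ'.edge h ∈ (ρ.c1 S).1) (fun h => (ρ.edge_half S h).symm))
    rw [card_halves, card_halves] at h1
    exact Nat.eq_of_mul_eq_mul_left two_pos h1
  let f := fun S => (hcard S).some
  let ε : Γ.E ≃ Γ'.E := (Equiv.sigmaFiberEquiv κ).symm.trans
    ((Equiv.sigmaCongr ρ.c1 f).trans (Equiv.sigmaFiberEquiv κ'))
  have hε : ∀ e, κ' (ε e) = ρ.c1 (κ e) := fun e => (f (κ e) ⟨e, rfl⟩).2
  refine ⟨ε, fun S e => ?_⟩
  rw [← hκ, ← hκ', hε, ρ.c1.apply_eq_iff_eq]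

/-- The components of `Γ ∖ S` are the components of the graph in which the half-edges over each
other C1-set are joined. Hence they do not depend on the gluing. -/
lemma delComp_eq (ρ : Regluing Γ Γ') (hconn : Γ.IsConnected) (hbr : ∀ e, ¬ Γ.IsSeparating e)
    (S : {S : Set Γ.E // Γ.IsC1Set S}) {v w : Γ.V} (h : delComp S.1 v = delComp S.1 w) :
    delComp (ρ.c1 S).1 (ρ.vertex v) = delComp (ρ.c1 S).1 (ρ.vertex w) := by
  let o := Classical.arbitrary Γ.Orientation
  let o' := Classical.arbitrary Γ'.Orientation
  let F : (Γ.delete S.1).Components → (Γ'.delete (ρ.c1 S).1).Components :=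
    Quot.lift (fun v : Γ.V => delComp (ρ.c1 S).1 (ρ.vertex v)) (by
      rintro _ _ ⟨h₁, h₂, -, he, rfl, rfl⟩
      change delComp (ρ.c1 S).1 (ρ.vertex (Γ.vert h₁.1)) =
        delComp (ρ.c1 S).1 (ρ.vertex (Γ.vert h₂.1))
      rw [← ρ.vert_half, ← ρ.vert_half]
      have he : Γ.edge h₁.1 = Γ.edge h₂.1 := congrArg Subtype.val he
      refine (ρ.c1 S).2.comp_delete_eq_of_coupled (o := o') ?_
        (by rw [ρ.edge_half]; exact h₁.2) (by rw [ρ.edge_half]; exact h₂.2)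
      let T : {S : Set Γ.E // Γ.IsC1Set S} := ⟨_, isC1Set_coupledClass hconn hbr o (Γ.edge h₁.1)⟩
      have m1 : Γ'.edge (ρ.half h₁.1) ∈ (ρ.c1 T).1 := by
        rw [ρ.edge_half]; exact Coupled.refl _ _
      have m2 : Γ'.edge (ρ.half h₂.1) ∈ (ρ.c1 T).1 := by
        rw [ρ.edge_half, ← he]; exact Coupled.refl _ _
      rw [(ρ.c1 T).2.eq_coupledClass o' m1] at m2
      exact m2)
  exact congrArg F h

/-- Signs on the vertices that turn the cyclic orientations `σ` of the C1-sets of `Γ` into the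
cyclic orientations `σ'` of those of `Γ'`, up to a sign for each C1-set. The sign of a vertex is
the product, over all C1-sets `S`, of the relative sign of `σ` and `σ'` on the component of `Γ ∖
S` containing the vertex; on the half-edges over another C1-set `T` the factor at `S` is constant.
-/
lemma exists_vertex_signs (ρ : Regluing Γ Γ') (hconn : Γ.IsConnected)
    (hbr : ∀ e, ¬ Γ.IsSeparating e) {σ : Γ.H → ℤˣ} {σ' : Γ'.H → ℤˣ}
    (hσ : ∀ S, Γ.IsC1Set S → ∀ h h', h ≠ h' → Γ.edge h ∈ S → Γ.edge h' ∈ S →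
      delComp S (Γ.vert h) = delComp S (Γ.vert h') → σ h' = - σ h)
    (hσ' : ∀ S, Γ'.IsC1Set S → ∀ h h', h ≠ h' → Γ'.edge h ∈ S → Γ'.edge h' ∈ S →
      delComp S (Γ'.vert h) = delComp S (Γ'.vert h') → σ' h' = - σ' h) :
    ∃ α : Γ.V → ℤˣ, ∀ S : {S : Set Γ.E // Γ.IsC1Set S}, ∀ h h', Γ.edge h ∈ S.1 → Γ.edge h' ∈ S.1 →
      α (Γ.vert h) * σ h * σ' (ρ.half h) = α (Γ.vert h') * σ h' * σ' (ρ.half h') := by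
  classical
  let o := Classical.arbitrary Γ.Orientation
  have hβ : ∀ S : {S : Set Γ.E // Γ.IsC1Set S}, ∃ b : (Γ.delete S.1).Components → ℤˣ,
      ∀ h, Γ.edge h ∈ S.1 → b (delComp S.1 (Γ.vert h)) = σ h * σ' (ρ.half h) := by
    intro S
    refine ⟨fun K => if H : ∃ h, Γ.edge h ∈ S.1 ∧ delComp S.1 (Γ.vert h) = K then
      σ H.choose * σ' (ρ.half H.choose) else 1, fun h hh => ?_⟩
    have H : ∃ h', Γ.edge h' ∈ S.1 ∧ delComp S.1 (Γ.vert h') = delComp S.1 (Γ.vert h) :=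
      ⟨h, hh, rfl⟩
    beta_reduce
    rw [dif_pos H]
    obtain ⟨h1, h2⟩ := H.choose_spec
    by_cases hne : h = H.choose
    · rw [← hne]
    · rw [hσ S.1 S.2 _ _ hne hh h1 h2.symm, hσ' (ρ.c1 S).1 (ρ.c1 S).2 (ρ.half h) (ρ.half H.choose)
        (fun h => hne (ρ.half.injective h)) ((ρ.edge_half S h).2 hh) ((ρ.edge_half S _).2 h1)]
      · simp
      · rw [ρ.vert_half, ρ.vert_half]
        exact ρ.delComp_eq hconn hbr S h2.symm
  choose b hb using hβ
  have : Fintype {S : Set Γ.E // Γ.IsC1Set S} := Fintype.ofFinite _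
  refine ⟨fun v => ∏ S, b S (delComp S.1 v), fun S h h' hh hh' => ?_⟩
  have key : ∀ h, Γ.edge h ∈ S.1 → (∏ T, b T (delComp T.1 (Γ.vert h))) * σ h * σ' (ρ.half h) =
      ∏ T ∈ Finset.univ.erase S, b T (delComp T.1 (Γ.vert h)) := by
    intro h hh
    rw [← Finset.mul_prod_erase _ _ (Finset.mem_univ S), hb S h hh, mul_comm, mul_comm _ (σ h),
      ← mul_assoc, ← mul_assoc, mul_comm _ (σ h), Int.units_mul_self, one_mul]
  rw [key h hh, key h' hh']
  refine Finset.prod_congr rfl fun T hT => ?_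
  -- Both half-edges lie over `S`, hence in the same component of `Γ ∖ T`.
  have hTS : ∀ h, Γ.edge h ∈ S.1 → Γ.edge h ∉ T.1 := by
    intro h hh hhT
    refine (Finset.mem_erase.1 hT).1 (Subtype.ext ?_)
    rw [T.2.eq_coupledClass o hhT, S.2.eq_coupledClass o hh]
  have hcoup : Coupled o (Γ.edge h) (Γ.edge h') := by
    rw [S.2.eq_coupledClass o hh] at hh'
    exact hh'
  exact congrArg (b T) (T.2.comp_delete_eq_of_coupled hcoup (hTS h hh) (hTS h' hh'))

/-- Any matching of the edges compatible with the C1-sets carries cycle classes to cycle classes,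
and up to signs at the vertices it is compatible with the given bijection of the half-edges. -/
theorem exists_orientation_signs [Finite Γ'.E] (ρ : Regluing Γ Γ') (hconn : Γ.IsConnected)
    (hbr : ∀ e, ¬ Γ.IsSeparating e) (hconn' : Γ'.IsConnected) (hbr' : ∀ e, ¬ Γ'.IsSeparating e)
    {ε : Γ.E ≃ Γ'.E} (hε : ∀ S e, ε e ∈ (ρ.c1 S).1 ↔ e ∈ S.1) (o : Γ.Orientation) :
    ∃ (o' : Γ'.Orientation) (α : Γ.V → ℤˣ),
      (∀ c, c ∈ H1 o ↔ chainEquiv ε c ∈ H1 o') ∧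
      ∀ c ∈ H1 o, ∀ h, flow o' (chainEquiv ε c) (ρ.half h) = α (Γ.vert h) * flow o c h := by
  obtain ⟨σ, hσ1, hσ2, hσ3⟩ := exists_cyclic_signs hconn hbr
  obtain ⟨σ', hσ1', hσ2', hσ3'⟩ := exists_cyclic_signs hconn' hbr'
  obtain ⟨α, hα⟩ := ρ.exists_vertex_signs hconn hbr hσ2 hσ2'
  have hcls : ∀ h : Γ.H, ∃ S : {S : Set Γ.E // Γ.IsC1Set S}, Γ.edge h ∈ S.1 :=
    fun h => ⟨⟨_, isC1Set_coupledClass hconn hbr o (Γ.edge h)⟩, Coupled.refl _ _⟩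
  -- The sign of an edge of `Γ` relative to the cyclic orientation of its C1-set.
  let τ : Γ.E → ℤˣ := fun e => σ (o.tgt e)
  have hτ : ∀ h, τ (Γ.edge h) = o.sgn h * σ h := by
    intro h
    rcases o.tgt_or_src h with h1 | h1
    · rw [← h1, o.sgn_tgt, o.edge_tgt, one_mul]
    · rw [← h1, o.sgn_src, o.edge_src, hσ1 (o.tgt (Γ.edge h)) (o.src (Γ.edge h))
        (o.src_ne_tgt _).symm (by rw [o.edge_tgt, o.edge_src])]
      simp [τ]
  obtain ⟨o', ho'⟩ := exists_orientation (Γ := Γ')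
    (fun h' => α (Γ.vert (ρ.half.symm h')) * σ (ρ.half.symm h') * τ (ε.symm (Γ'.edge h'))) (by
      intro h₁' h₂' hne he
      obtain ⟨h₁, rfl⟩ := ρ.half.surjective h₁'
      obtain ⟨h₂, rfl⟩ := ρ.half.surjective h₂'
      obtain ⟨S, hS⟩ := hcls h₁
      have hS' : Γ.edge h₂ ∈ S.1 := by
        rw [← ρ.edge_half, ← he, ρ.edge_half]; exact hS
      have h1 := hα S h₁ h₂ hS hS'
      rw [hσ1' _ _ hne he] at h1
      simp only [Equiv.symm_apply_apply, ← he]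
      rw [← neg_mul]
      congr 1
      have h2 : α (Γ.vert h₁) * σ h₁ * σ' (ρ.half h₁) =
          (-(α (Γ.vert h₂) * σ h₂)) * σ' (ρ.half h₁) := by
        rw [h1, mul_neg, neg_mul]
      rw [mul_right_cancel h2, neg_neg])
  have hs : ∀ h, o'.sgn (ρ.half h) =
      α (Γ.vert h) * σ h * τ (ε.symm (Γ'.edge (ρ.half h))) := by
    intro h
    rw [ho']
    simp only [Equiv.symm_apply_apply]
  have hmem : ∀ S : {S : Set Γ.E // Γ.IsC1Set S}, ∀ h, Γ.edge h ∈ S.1 →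
      ε.symm (Γ'.edge (ρ.half h)) ∈ S.1 := by
    intro S h hh
    rw [← hε, ε.apply_symm_apply, ρ.edge_half]; exact hh
  have hflow' : ∀ c h, flow o' (chainEquiv ε c) (ρ.half h) =
      α (Γ.vert h) * σ h * (τ (ε.symm (Γ'.edge (ρ.half h))) *
        c (ε.symm (Γ'.edge (ρ.half h)))) := by
    intro c h
    rw [flow_apply, hs, ← chainEquiv_apply ε c, ε.apply_symm_apply]
    push_cast
    ring
  -- A flow that is a multiple of the cyclic orientation on every C1-set is transformed as wanted.
  have key : ∀ c, (∀ S : {S : Set Γ.E // Γ.IsC1Set S}, ∃ n : ℤ, ∀ h, Γ.edge h ∈ S.1 →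
      flow o c h = n * σ h) →
      ∀ h, flow o' (chainEquiv ε c) (ρ.half h) = α (Γ.vert h) * flow o c h := by
    intro c hc h
    obtain ⟨S, hS⟩ := hcls h
    obtain ⟨n, hn⟩ := hc S
    have h1 : ∀ e ∈ S.1, c e = n * τ e := by
      intro e he
      have := hn (o.tgt e) (by rw [o.edge_tgt]; exact he)
      rw [flow_apply, o.sgn_tgt, o.edge_tgt] at this
      simpa using this
    rw [hflow', h1 _ (hmem S h hS), hn h hS]
    have := Int.units_coe_mul_self (τ (ε.symm (Γ'.edge (ρ.half h))))
    linear_combination (α (Γ.vert h) * σ h * n : ℤ) * this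
  have key2 : ∀ c, (∀ S : {S : Set Γ.E // Γ.IsC1Set S}, ∃ n : ℤ, ∀ h, Γ.edge h ∈ S.1 →
      flow o c h = n * σ h) → (c ∈ H1 o ↔ chainEquiv ε c ∈ H1 o') := by
    intro c hc
    have h1 := key c hc
    let x := Finsupp.equivMapDomain ρ.half.symm (flow o' (chainEquiv ε c))
    have hx : ∀ h, x h = α (Γ.vert h) * flow o c h := h1
    have hx' : flow o' (chainEquiv ε c) = Finsupp.mapDomain ρ.half x := by
      rw [← Finsupp.equivMapDomain_eq_mapDomain, ← Finsupp.equivMapDomain_trans]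
      simp
    have h2 : Finsupp.mapDomain Γ'.vert (flow o' (chainEquiv ε c)) =
        Finsupp.mapDomain ρ.vertex (Finsupp.mapDomain Γ.vert x) := by
      rw [hx', ← Finsupp.mapDomain_comp, ← Finsupp.mapDomain_comp]
      congr 1
      funext h
      exact ρ.vert_half h
    rw [mem_H1_iff, mem_H1_iff, h2,
      (Finsupp.mapDomain_injective ρ.vertex.injective).eq_iff' Finsupp.mapDomain_zero]
    rw [Finsupp.ext_iff, Finsupp.ext_iff]
    refine forall_congr' fun v => ?_
    rw [mapDomain_mul_apply Γ.vert (fun v => (α v : ℤ)) (flow o c) x hx]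
    simp
  refine ⟨o', α, fun c => ⟨fun hc => ?_, fun hc => ?_⟩, fun c hc => ?_⟩
  · exact (key2 c fun S => hσ3 o c hc S.1 S.2).1 hc
  · refine (key2 c fun S => ?_).2 hc
    obtain ⟨n, hn⟩ := hσ3' o' _ hc (ρ.c1 S).1 (ρ.c1 S).2
    obtain ⟨e₀, he₀⟩ := S.2.nonempty
    refine ⟨n * (α (Γ.vert (o.tgt e₀)) * σ (o.tgt e₀) * σ' (ρ.half (o.tgt e₀)) : ℤˣ),
      fun h hh => ?_⟩
    -- Choose a half-edge of `Γ` that becomes a half-edge of the edge corresponding to `edge h`.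
    obtain ⟨h₁, hh₁⟩ : ∃ h₁, Γ'.edge (ρ.half h₁) = ε (Γ.edge h) :=
      ⟨ρ.half.symm (o'.tgt (ε (Γ.edge h))), by rw [ρ.half.apply_symm_apply, o'.edge_tgt]⟩
    have hS₁ : Γ.edge h₁ ∈ S.1 := by rw [← ρ.edge_half, hh₁, hε]; exact hh
    have h1 := hn (ρ.half h₁) ((ρ.edge_half S h₁).2 hS₁)
    rw [hflow', hh₁, ε.symm_apply_apply, hτ] at h1
    rw [hα S _ h₁ (by rw [o.edge_tgt]; exact he₀) hS₁, flow_apply]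
    have a1 := Int.units_coe_mul_self (α (Γ.vert h₁))
    have a2 := Int.units_coe_mul_self (σ h₁)
    have a3 := Int.units_coe_mul_self (σ h)
    push_cast at h1 ⊢
    linear_combination (α (Γ.vert h₁) * σ h₁ * σ h : ℤ) * h1 -
      (o.sgn h * c (Γ.edge h)) * (σ h * σ h * (σ h₁ * σ h₁ * a1 + a2) + a3)
  · exact key c (fun S => hσ3 o c hc S.1 S.2)

end Regluing

end HGraph

open Topology TopologicalSpace

/-! ### Topology of curves -/

lemma isIrreducible_preimage_val {X : Type*} [TopologicalSpace X] {Y W : Set X}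
    (hW : IsIrreducible W) (hWY : W ⊆ Y) : IsIrreducible ((↑) ⁻¹' W : Set Y) := by
  obtain ⟨x, hx⟩ := hW.nonempty
  refine ⟨⟨⟨x, hWY hx⟩, hx⟩, ?_⟩
  rintro _ _ ⟨u, hu, rfl⟩ ⟨v, hv, rfl⟩ ⟨a, ha, hau⟩ ⟨b, hb, hbv⟩
  obtain ⟨y, hy, hyu, hyv⟩ := hW.2 u v hu hv ⟨a, ha, hau⟩ ⟨b, hb, hbv⟩
  exact ⟨⟨y, hWY hy⟩, hy, hyu, hyv⟩

/-- In a space of pure dimension one, an irreducible closed set disjoint from a dense open set is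
the closure of each of its points. -/
lemma eq_closure_of_disjoint_dense {X : Type*} [TopologicalSpace X] [NoetherianSpace X]
    (hdim : ∀ Z ∈ irreducibleComponents X, topologicalKrullDim Z = 1) {U : Set X} (hU : Dense U)
    {Z : Set X} (hZ : IsIrreducible Z) (hZc : IsClosed Z) (hZU : Disjoint Z U) {x : X}
    (hx : x ∈ Z) : Z = closure {x} := by
  by_contra hne
  have h1 : closure {x} ⊂ Z :=
    (hZc.closure_subset_iff.2 (Set.singleton_subset_iff.2 hx)).ssubset_of_ne (Ne.symm hne)
  obtain ⟨Y, hY, hZY⟩ := exists_mem_irreducibleComponents_subset_of_isIrreducible Z hZ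
  have h2 : Z ⊂ Y := by
    refine hZY.ssubset_of_ne ?_
    rintro rfl
    obtain ⟨u, hu, hne, hus⟩ :=
      NoetherianSpace.exists_isOpen_nonempty_subset_irreducibleComponent Z hY
    obtain ⟨y, hyu, hyU⟩ := hU.inter_open_nonempty u hu hne
    exact Set.disjoint_left.1 hZU (hus hyu) hyU
  have hYc : IsClosed Y := isClosed_of_mem_irreducibleComponents Y hY
  have hss : ∀ W W' : Set X, W' ⊆ Y → W ⊂ W' →
      ((↑) ⁻¹' W : Set Y) ⊂ (↑) ⁻¹' W' := by
    intro W W' hWY' h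
    refine ⟨fun y hy => h.1 hy, fun h' => h.2 fun y hy => ?_⟩
    exact @h' ⟨y, hWY' hy⟩ hy
  let a : IrreducibleCloseds Y := ⟨(↑) ⁻¹' closure {x},
    isIrreducible_preimage_val isIrreducible_singleton.closure (h1.1.trans h2.1),
    isClosed_closure.preimage continuous_subtype_val⟩
  let b : IrreducibleCloseds Y :=
    ⟨(↑) ⁻¹' Z, isIrreducible_preimage_val hZ h2.1, hZc.preimage continuous_subtype_val⟩
  let c : IrreducibleCloseds Y :=
    ⟨(↑) ⁻¹' Y, isIrreducible_preimage_val hY.1 subset_rfl, hYc.preimage continuous_subtype_val⟩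
  have hab : a < b := SetLike.coe_ssubset_coe.1 (hss _ _ h2.1 h1)
  have hbc : b < c := SetLike.coe_ssubset_coe.1 (hss _ _ subset_rfl h2)
  have h3 : ((2 : ℕ) : WithBot ℕ∞) ≤ topologicalKrullDim Y :=
    Order.le_krullDim_iff.2 ⟨⟨2, ![a, b, c], fun i => by fin_cases i; exacts [hab, hbc]⟩, rfl⟩
  rw [hdim Y hY] at h3
  exact absurd h3 (by decide)

/-- In a noetherian space of pure dimension one, a dense open set contains all but finitely many
closed points. -/
lemma finite_closed_points_notMem_dense {X : Type*} [TopologicalSpace X] [NoetherianSpace X]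
    (hdim : ∀ Z ∈ irreducibleComponents X, topologicalKrullDim Z = 1) {U : Set X} (hU : Dense U)
    (hUo : IsOpen U) : {p : X | IsClosed {p} ∧ p ∉ U}.Finite := by
  obtain ⟨S, hS, hSc, hSi, hSU⟩ :=
    NoetherianSpace.exists_finite_set_isClosed_irreducible hUo.isClosed_compl
  refine Set.Finite.of_finite_image (f := fun p => ({p} : Set X)) (hS.subset ?_)
    Set.singleton_injective.injOn
  rintro _ ⟨p, ⟨hp, hpU⟩, rfl⟩
  have : p ∈ ⋃₀ S := by rw [← hSU]; exact hpU
  obtain ⟨Z, hZ, hpZ⟩ := this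
  have h := eq_closure_of_disjoint_dense hdim hU (hSi Z hZ) (hSc Z hZ)
    (Set.disjoint_left.2 fun y hy => by
      have : y ∈ Uᶜ := by rw [hSU]; exact ⟨Z, hZ, hy⟩
      exact this) hpZ
  rw [hp.closure_eq] at h
  change {p} ∈ S
  exact h ▸ hZ

lemma isClosed_singleton_of_notMem_dense {X : Type*} [TopologicalSpace X] [NoetherianSpace X]
    [T0Space X] (hdim : ∀ Z ∈ irreducibleComponents X, topologicalKrullDim Z = 1) {U : Set X}
    (hU : Dense U) (hUo : IsOpen U) {p : X} (hp : p ∉ U) : IsClosed {p} := by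
  have hsub : closure {p} ⊆ Uᶜ :=
    hUo.isClosed_compl.closure_subset_iff.2 (Set.singleton_subset_iff.2 hp)
  rw [← closure_eq_iff_isClosed]
  refine Set.Subset.antisymm (fun x hx => ?_) subset_closure
  have h := eq_closure_of_disjoint_dense hdim hU isIrreducible_singleton.closure isClosed_closure
    (Set.disjoint_left.2 fun y hy => hsub hy) hx
  exact (inseparable_iff_closure_eq.2 h).eq.symm

lemma finite_connectedComponents {X : Type*} [TopologicalSpace X] [NoetherianSpace X] :
    Finite (ConnectedComponents X) := by
  have := (NoetherianSpace.finite_irreducibleComponents (α := X)).to_subtype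
  refine Finite.of_surjective (α := irreducibleComponents X)
    (fun Z => ConnectedComponents.mk Z.2.1.nonempty.choose) ?_
  intro c
  obtain ⟨x, rfl⟩ := ConnectedComponents.surjective_coe c
  refine ⟨⟨irreducibleComponent x, irreducibleComponent_mem_irreducibleComponents x⟩, ?_⟩
  have hpc : IsPreconnected (irreducibleComponent x) :=
    isIrreducible_irreducibleComponent.isPreirreducible.isPreconnected
  rw [ConnectedComponents.coe_eq_coe']
  exact hpc.subset_connectedComponent mem_irreducibleComponent (Set.Nonempty.some_mem _)

/-- In a noetherian scheme, a point whose local ring is a domain has an irreducible open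
neighbourhood, since it lies on a single irreducible component. -/
lemma exists_irreducible_open_nhd {X : Scheme.{u}} [IsNoetherian X] (p : X)
    [IsDomain (X.presheaf.stalk p)] : ∃ V : Set X, IsOpen V ∧ p ∈ V ∧ IsIrreducible V := by
  have hfin := NoetherianSpace.finite_irreducibleComponents (α := X)
  obtain ⟨η, hη⟩ := QuasiSober.sober (S := (Set.univ : Set (Spec (X.presheaf.stalk p))))
    (by
      have : IrreducibleSpace (PrimeSpectrum (X.presheaf.stalk p)) := inferInstance
      exact IrreducibleSpace.isIrreducible_univ _) isClosed_univ
  -- All components through `p` equal the closure of the image of the generic point `η`.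
  have key : ∀ W ∈ irreducibleComponents X, p ∈ W → W = closure {X.fromSpecStalk p η} := by
    intro W hW hpW
    obtain ⟨w, hw⟩ := QuasiSober.sober hW.1 (isClosed_of_mem_irreducibleComponents W hW)
    have hwp : w ⤳ p := by
      rw [specializes_iff_mem_closure, hw.def]; exact hpW
    obtain ⟨w', rfl⟩ : w ∈ Set.range (X.fromSpecStalk p) := by
      rw [Scheme.range_fromSpecStalk]; exact hwp
    have h1 : X.fromSpecStalk p η ⤳ X.fromSpecStalk p w' :=
      (hη.specializes (Set.mem_univ w')).map (X.fromSpecStalk p).continuous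
    have h2 : W ⊆ closure {X.fromSpecStalk p η} := by
      rw [← hw.def]
      exact specializes_iff_closure_subset.1 h1
    exact h2.antisymm (hW.2 isIrreducible_singleton.closure h2)
  obtain ⟨Y, hY⟩ : ∃ Y, irreducibleComponent p = Y := ⟨_, rfl⟩
  have hYc : Y ∈ irreducibleComponents X := hY ▸ irreducibleComponent_mem_irreducibleComponents p
  have hpY : p ∈ Y := hY ▸ mem_irreducibleComponent
  have hVo : IsOpen (⋃₀ (irreducibleComponents X \ {Y}))ᶜ := by
    rw [Set.sUnion_eq_biUnion, isOpen_compl_iff]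
    exact hfin.sdiff.isClosed_biUnion fun W hW => isClosed_of_mem_irreducibleComponents W hW.1
  have hpV : p ∈ (⋃₀ (irreducibleComponents X \ {Y}))ᶜ := by
    rintro ⟨W, ⟨hW, hWY⟩, hpW⟩
    exact hWY ((key W hW hpW).trans (key Y hYc hpY).symm)
  refine ⟨_, hVo, hpV, ⟨p, hpV⟩, hYc.1.2.open_subset hVo fun x hx => ?_⟩
  by_contra hxY
  exact hx ⟨irreducibleComponent x, ⟨irreducibleComponent_mem_irreducibleComponents x,
    fun h => hxY (h ▸ mem_irreducibleComponent)⟩, mem_irreducibleComponent⟩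

namespace NodalCurve

variable {k : Type u} [Field k] [IsAlgClosed k] (C : NodalCurve k)

/-! ### The dual graph of a nodal curve -/

instance : IsNoetherian C.X.left := by
  have := C.proper
  have : IsNoetherian (Spec (CommRingCat.of k)) := inferInstance
  have h1 := LocallyOfFiniteType.isLocallyNoetherian C.X.hom
  have h2 := QuasiCompact.compactSpace_of_compactSpace C.X.hom
  exact { h1, h2 with }

instance : IsFinite C.ν.left := C.isNormalization.finite

instance : IsNoetherian C.N.left := by
  have h1 := LocallyOfFiniteType.isLocallyNoetherian C.ν.left
  have h2 := QuasiCompact.compactSpace_of_compactSpace C.ν.left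
  exact { h1, h2 with }

instance : Finite (ConnectedComponents C.N.left) := finite_connectedComponents

instance : Finite C.dualGraph.V := inferInstanceAs (Finite (ConnectedComponents C.N.left))

/-- The normalization map is bijective over a dense open set `U`, and open over `U`. -/
lemma exists_dense_open : ∃ U : Set C.X.left, IsOpen U ∧ Dense U ∧ Dense (C.ν.left ⁻¹' U) ∧
    U ⊆ Set.range C.ν.left ∧ Set.InjOn C.ν.left (C.ν.left ⁻¹' U) ∧
    ∀ A : Set C.N.left, IsOpen A → A ⊆ C.ν.left ⁻¹' U → IsOpen (C.ν.left '' A) := by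
  obtain ⟨U, hU, hU', hiso⟩ := C.isNormalization.birational
  have hg : IsOpenImmersion ((C.ν.left ⁻¹ᵁ U).ι ≫ C.ν.left) := by
    rw [← morphismRestrict_ι]; infer_instance
  have hemb := ((C.ν.left ⁻¹ᵁ U).ι ≫ C.ν.left).isOpenEmbedding
  refine ⟨U, U.2, hU, hU', ?_, ?_, ?_⟩
  · intro x hx
    obtain ⟨y, hy⟩ := (C.ν.left ∣_ U).surjective ⟨x, hx⟩
    exact ⟨y.1, by rw [← morphismRestrict_base_coe, hy]⟩
  · intro a ha b hb hab
    have := @hemb.injective ⟨a, ha⟩ ⟨b, hb⟩ hab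
    exact congrArg Subtype.val this
  · intro A hA hAU
    have h := hemb.isOpenMap ((C.ν.left ⁻¹ᵁ U).ι ⁻¹' A)
      (hA.preimage (C.ν.left ⁻¹ᵁ U).ι.continuous)
    convert h using 1
    ext x
    constructor
    · rintro ⟨a, ha, rfl⟩
      exact ⟨⟨a, hAU ha⟩, ha, rfl⟩
    · rintro ⟨a, ha, rfl⟩
      exact ⟨a.1, ha, rfl⟩

lemma ν_surjective : Function.Surjective C.ν.left := by
  obtain ⟨U, -, hU, -, hUr, -⟩ := C.exists_dense_open
  have hcl : IsClosed (Set.range C.ν.left) := C.ν.left.isClosedMap.isClosed_range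
  rw [← Set.range_eq_univ]
  exact hcl.closure_eq.symm.trans ((hU.mono hUr).closure_eq)

lemma notMem_of_mem_nodes {U : Set C.X.left} (hinj : Set.InjOn C.ν.left (C.ν.left ⁻¹' U))
    {p : C.X.left} (hp : p ∈ C.nodes) : p ∉ U := by
  intro hpU
  obtain ⟨a, b, hab, H, -⟩ := C.nodal p hp
  have ha := (H a).2 (Or.inl rfl)
  have hb := (H b).2 (Or.inr rfl)
  refine hab (hinj ?_ ?_ (ha.trans hb.symm))
  · rw [Set.mem_preimage, ha]; exact hpU
  · rw [Set.mem_preimage, hb]; exact hpU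

lemma finite_nodes : C.nodes.Finite := by
  obtain ⟨U, hUo, hU, -, -, hinj, -⟩ := C.exists_dense_open
  exact (finite_closed_points_notMem_dense C.pureDimOne hU hUo).subset
    fun p hp => ⟨hp.1, C.notMem_of_mem_nodes hinj hp⟩

instance : Finite C.dualGraph.E := C.finite_nodes.to_subtype

/-- The points of the normalization over a point that is not a node lie on the same component. -/
lemma mk_eq_mk_of_notMem_nodes {a b : C.N.left} (hab : C.ν.left a = C.ν.left b)
    (hp : C.ν.left a ∉ C.nodes) : ConnectedComponents.mk a = ConnectedComponents.mk b := by
  obtain ⟨U, hUo, hU, hU', -, hinj, hopen⟩ := C.exists_dense_open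
  by_cases hpU : C.ν.left a ∈ U
  · rw [hinj hpU (by rw [Set.mem_preimage, ← hab]; exact hpU) hab]
  have hcl := isClosed_singleton_of_notMem_dense C.pureDimOne hU hUo hpU
  have hdom : IsDomain (C.X.left.presheaf.stalk (C.ν.left a)) := by
    by_contra h
    exact hp ⟨hcl, fun ⟨h', _⟩ => h h'⟩
  obtain ⟨V, hVo, hpV, hV⟩ := exists_irreducible_open_nhd (C.ν.left a)
  by_contra hne
  -- A clopen set separating `a` from `b` would give disjoint nonempty open subsets of `V`.
  let A : Set C.N.left := ConnectedComponents.mk ⁻¹' {ConnectedComponents.mk a}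
  have hA : IsClopen A := (isClopen_discrete _).preimage ConnectedComponents.continuous_coe
  have key : ∀ B : Set C.N.left, IsOpen B → ∀ x ∈ B, C.ν.left x = C.ν.left a →
      (V ∩ C.ν.left '' (B ∩ C.ν.left ⁻¹' V ∩ C.ν.left ⁻¹' U)).Nonempty ∧
      IsOpen (C.ν.left '' (B ∩ C.ν.left ⁻¹' V ∩ C.ν.left ⁻¹' U)) := by
    intro B hB x hx hxa
    have hBV : IsOpen (B ∩ C.ν.left ⁻¹' V) := hB.inter (hVo.preimage C.ν.left.continuous)
    obtain ⟨y, hy, hyU⟩ := hU'.inter_open_nonempty _ hBV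
      ⟨x, hx, by rw [Set.mem_preimage, hxa]; exact hpV⟩
    exact ⟨⟨_, hy.2, y, ⟨hy, hyU⟩, rfl⟩,
      hopen _ (hBV.inter (hUo.preimage C.ν.left.continuous)) Set.inter_subset_right⟩
  obtain ⟨h1, h2⟩ := key A hA.isOpen a rfl rfl
  obtain ⟨h3, h4⟩ := key Aᶜ hA.compl.isOpen b (fun h => hne (Eq.symm h)) hab.symm
  obtain ⟨y, -, ⟨x, ⟨hx, hxU⟩, rfl⟩, ⟨x', ⟨hx', hxU'⟩, hxx⟩⟩ := hV.2 _ _ h2 h4 h1 h3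
  exact hx'.1 ((hinj hxU' hxU hxx) ▸ hx.1)

/-- If a union `A` of components of `N` is not linked to its complement by nodes outside `P`, then
the images of `A` and its complement meet only in `P`. -/
lemma mem_of_mem_image_inter {A : Set (ConnectedComponents C.N.left)} {P : Set C.dualGraph.E}
    (hA : ∀ h h' : C.dualGraph.H, C.dualGraph.edge h = C.dualGraph.edge h' →
      C.dualGraph.edge h ∉ P → C.dualGraph.vert h ∈ A → C.dualGraph.vert h' ∈ A)
    {a b : C.N.left} (hab : C.ν.left a = C.ν.left b) (ha : ConnectedComponents.mk a ∈ A)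
    (hb : ConnectedComponents.mk b ∉ A) :
    ∃ hp : C.ν.left a ∈ C.nodes, (⟨C.ν.left a, hp⟩ : C.nodes) ∈ P := by
  by_cases hp : C.ν.left a ∈ C.nodes
  · refine ⟨hp, ?_⟩
    by_contra hP
    exact hb (hA ⟨a, hp⟩ ⟨b, hab ▸ hp⟩ (Subtype.ext hab) hP ha)
  · exact absurd (C.mk_eq_mk_of_notMem_nodes hab hp ▸ ha) hb

lemma isClopen_preimage_mk (A : Set (ConnectedComponents C.N.left)) :
    IsClopen (ConnectedComponents.mk ⁻¹' A : Set C.N.left) :=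
  (isClopen_discrete _).preimage ConnectedComponents.continuous_coe

lemma isConnected_dualGraph [ConnectedSpace C.X.left] : C.dualGraph.IsConnected := by
  obtain ⟨x₀⟩ := (inferInstance : Nonempty C.X.left)
  obtain ⟨q₀, -⟩ := C.ν_surjective x₀
  refine ⟨⟨HGraph.comp (Γ := C.dualGraph) (ConnectedComponents.mk q₀)⟩, ⟨?_⟩⟩
  rintro ⟨v⟩ ⟨w⟩
  obtain ⟨a, rfl⟩ := ConnectedComponents.surjective_coe v
  obtain ⟨b, rfl⟩ := ConnectedComponents.surjective_coe w
  by_contra hne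
  let A : Set (ConnectedComponents C.N.left) := {v | HGraph.comp (Γ := C.dualGraph) v =
    HGraph.comp (Γ := C.dualGraph) (ConnectedComponents.mk a)}
  have hA := C.isClopen_preimage_mk A
  have hcl1 := C.ν.left.isClosedMap _ hA.isClosed
  have hcl2 := C.ν.left.isClosedMap _ hA.compl.isClosed
  obtain ⟨y, -, ⟨x, hx, rfl⟩, ⟨x', hx', hxx⟩⟩ :=
    isPreconnected_closed_iff.1 (isPreconnected_univ (α := C.X.left)) _ _ hcl1 hcl2
    (by
      intro y _
      obtain ⟨x, rfl⟩ := C.ν_surjective y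
      by_cases hx : ConnectedComponents.mk x ∈ A
      · exact Or.inl ⟨x, hx, rfl⟩
      · exact Or.inr ⟨x, hx, rfl⟩)
    ⟨_, trivial, a, rfl, rfl⟩ ⟨_, trivial, b, fun h => hne (Eq.symm h), rfl⟩
  obtain ⟨_, h⟩ := C.mem_of_mem_image_inter (A := A) (P := ∅) (fun h h' he _ hh =>
    (HGraph.comp_vert_eq he).symm.trans hh) hxx.symm hx hx'
  exact h

/-- Removing a separating edge from the dual graph corresponds to removing a separating node from
the curve. -/
lemma isSeparatingNode_of_isSeparating [ConnectedSpace C.X.left] {e : C.dualGraph.E}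
    (he : C.dualGraph.IsSeparating e) : C.IsSeparatingNode e.1 := by
  obtain ⟨p, hp⟩ := e
  refine ⟨hp, ?_⟩
  have hX : ENat.card (ConnectedComponents C.X.left) = 1 := by
    rw [ENat.card_eq_one_iff_unique, unique_iff_subsingleton_and_nonempty]
    exact ⟨inferInstance, inferInstance⟩
  have hΓ : ENat.card C.dualGraph.Components = 1 := by
    rw [ENat.card_eq_one_iff_unique, unique_iff_subsingleton_and_nonempty]
    exact ⟨C.isConnected_dualGraph.2, C.isConnected_dualGraph.1⟩
  rw [hX, ENat.one_lt_card_iff_nontrivial]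
  unfold HGraph.IsSeparating at he
  rw [hΓ, ENat.one_lt_card_iff_nontrivial] at he
  obtain ⟨⟨v⟩, ⟨w⟩, hvw⟩ := he
  let e : C.dualGraph.E := ⟨p, hp⟩
  let A : Set (ConnectedComponents C.N.left) :=
    {x | HGraph.delComp (Γ := C.dualGraph) {e} x = HGraph.delComp (Γ := C.dualGraph) {e} v}
  have hA := C.isClopen_preimage_mk A
  obtain ⟨U, hUo, hU, hU', -, hinj, -⟩ := C.exists_dense_open
  have hpU := C.notMem_of_mem_nodes hinj hp
  -- Every component of `N` has points that do not lie over `p`.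
  have hpt : ∀ c : ConnectedComponents C.N.left, ∃ x, ConnectedComponents.mk x = c ∧
      C.ν.left x ≠ p := by
    intro c
    obtain ⟨x, hx⟩ := ConnectedComponents.surjective_coe c
    obtain ⟨y, hy, hyU⟩ := hU'.inter_open_nonempty _ (C.isClopen_preimage_mk {c}).isOpen ⟨x, hx⟩
    exact ⟨y, hy, fun h => hpU (h ▸ hyU)⟩
  have hsep : ∀ x x' : C.N.left, C.ν.left x = C.ν.left x' → ConnectedComponents.mk x ∈ A →
      ConnectedComponents.mk x' ∉ A → C.ν.left x = p := by
    intro x x' hxx hx hx'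
    obtain ⟨_, h⟩ := C.mem_of_mem_image_inter (A := A) (P := {e}) (fun h h' he hP hh =>
      (HGraph.comp_delete_eq he hP).symm.trans hh) hxx hx hx'
    exact congrArg Subtype.val h
  let B : Set ({p}ᶜ : Set C.X.left) := (↑) ⁻¹' (C.ν.left '' (ConnectedComponents.mk ⁻¹' A))
  have hBc : Bᶜ = (↑) ⁻¹' (C.ν.left '' (ConnectedComponents.mk ⁻¹' A)ᶜ) := by
    ext y
    constructor
    · intro hy
      obtain ⟨x, hx⟩ := C.ν_surjective y.1
      exact ⟨x, fun h => hy ⟨x, h, hx⟩, hx⟩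
    · rintro ⟨x', hx', hxy'⟩ ⟨x, hx, hxy⟩
      exact y.2 (hxy.symm.trans (hsep x x' (hxy.trans hxy'.symm) hx hx'))
  have hB : IsClopen B := by
    refine ⟨(C.ν.left.isClosedMap _ hA.isClosed).preimage continuous_subtype_val, ?_⟩
    rw [← isClosed_compl_iff, hBc]
    exact (C.ν.left.isClosedMap _ hA.compl.isClosed).preimage continuous_subtype_val
  obtain ⟨x, hxv, hxp⟩ := hpt v
  obtain ⟨x', hxw, hxp'⟩ := hpt w
  have hxB : (⟨C.ν.left x, hxp⟩ : ({p}ᶜ : Set C.X.left)) ∈ B :=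
    ⟨x, by rw [Set.mem_preimage, hxv]; exact rfl, rfl⟩
  have hxB' : (⟨C.ν.left x', hxp'⟩ : ({p}ᶜ : Set C.X.left)) ∈ Bᶜ := by
    rw [hBc]
    refine ⟨x', fun h => hvw ?_, rfl⟩
    rw [Set.mem_preimage, hxw] at h
    exact h.symm
  refine ⟨ConnectedComponents.mk ⟨_, hxp⟩, ConnectedComponents.mk ⟨_, hxp'⟩, fun h => hxB' ?_⟩
  rw [ConnectedComponents.coe_eq_coe] at h
  exact hB.connectedComponent_subset hxB (h ▸ mem_connectedComponent)

end NodalCurve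

namespace NodalCurve

variable {k : Type u} [Field k] [IsAlgClosed k] {C C' : NodalCurve k}

/-! ### Divisors of cycle classes -/

lemma etaTilde_eq (o : C.dualGraph.Orientation) (c : C.dualGraph.E →₀ ℤ) :
    etaTilde o c = Finsupp.mapDomain C.halfPoint (HGraph.flow o c) := by
  have := (Finsupp.mapDomain.addMonoidHom (M := ℤ) C.halfPoint).map_sub
    (Finsupp.mapDomain o.tgt c) (Finsupp.mapDomain o.src c)
  simp only [Finsupp.mapDomain.addMonoidHom_apply] at this
  simp only [etaTilde, HGraph.flow, AddMonoidHom.sub_apply, Finsupp.mapDomain.addMonoidHom_apply,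
    this, ← Finsupp.mapDomain_comp]
  rfl

lemma halfPoint_injective : Function.Injective C.halfPoint := by
  intro a b h
  have h' : a.1 = b.1 := congrArg (fun z : closedPoints C.N.left => z.1) h
  exact Subtype.ext h'

/-- The multiplicity of the divisor of a chain at a gluing point is the value of the flow. -/
lemma etaTilde_halfPoint (o : C.dualGraph.Orientation) (c : C.dualGraph.E →₀ ℤ)
    (q : C.dualGraph.H) : etaTilde o c (C.halfPoint q) = HGraph.flow o c q := by
  rw [etaTilde_eq, Finsupp.mapDomain_apply halfPoint_injective]

lemma etaTilde_apply_of_notMem (o : C.dualGraph.Orientation) (c : C.dualGraph.E →₀ ℤ)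
    {x : closedPoints C.N.left} (hx : C.ν.left x.1 ∉ C.nodes) : etaTilde o c x = 0 := by
  rw [etaTilde_eq, Finsupp.mapDomain_of_notMem_range]
  rintro ⟨q, rfl⟩
  exact hx q.2

/-- A point of the normalization over a node, as a half-edge. -/
def halfEdge {x : C.N.left} (h : C.ν.left x ∈ C.nodes) : C.dualGraph.H := ⟨x, h⟩

lemma etaTilde_halfPoint_ne_zero_iff (o : C.dualGraph.Orientation) (c : C.dualGraph.E →₀ ℤ)
    (q : C.dualGraph.H) : etaTilde o c (C.halfPoint q) ≠ 0 ↔ c (C.dualGraph.edge q) ≠ 0 := by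
  rw [etaTilde_halfPoint, HGraph.flow_apply, mul_ne_zero_iff_left (o.sgn q).ne_zero]

/-- The compatibility of `η` with an isomorphism of the normalizations, point by point. -/
lemma divMap0_eta_eq_iff (φ : C.N.left ≅ C'.N.left) (o : C.dualGraph.Orientation)
    (o' : C'.dualGraph.Orientation) (α : ConnectedComponents C.N.left → ℤˣ) (c : HGraph.H1 o)
    (c' : HGraph.H1 o') :
    divMap0 φ (signAction0 α (eta o c)) = eta o' c' ↔
      ∀ x, etaTilde o' c'.1 (closedPointsEquiv φ x) =
        α (ConnectedComponents.mk x.1) * etaTilde o c.1 x := by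
  have h1 : ∀ x, (divMap0 φ (signAction0 α (eta o c))).1 (closedPointsEquiv φ x) =
      α (ConnectedComponents.mk x.1) * etaTilde o c.1 x := by
    intro x
    change Finsupp.equivMapDomain (closedPointsEquiv φ) (signAction α (etaTilde o c.1))
      (closedPointsEquiv φ x) = _
    rw [Finsupp.equivMapDomain_apply, Equiv.symm_apply_apply, signAction_apply]
  constructor
  · intro h x
    rw [← h1, h]
    rfl
  · intro h
    apply Subtype.ext
    ext y
    obtain ⟨x, rfl⟩ := (closedPointsEquiv φ).surjective y
    rw [h1, ← h]
    rfl

/-! ### From T-equivalence to C1-equivalence -/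

lemma mem_gluingSet {S : Set C.dualGraph.E} {x : C.N.left} :
    x ∈ C.gluingSet S ↔ ∃ h : C.ν.left x ∈ C.nodes, C.dualGraph.edge (halfEdge h) ∈ S := Iff.rfl

/-- The gluing points over a cycle class are the support of its divisor, and the points over the
edges coupled to a given edge can be recovered from these supports. -/
lemma image_gluingSet_coupledClass (φ : C.N.left ≅ C'.N.left)
    {ε : C.dualGraph.E ≃ C'.dualGraph.E} {o : C.dualGraph.Orientation}
    {o' : C'.dualGraph.Orientation} (hbr : ∀ e, ¬ C.dualGraph.IsSeparating e)
    (hsupp : ∀ c ∈ HGraph.H1 o, ∀ x, etaTilde o c x ≠ 0 ↔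
      etaTilde o' (HGraph.chainEquiv ε c) (closedPointsEquiv φ x) ≠ 0)
    (e : C.dualGraph.E) :
    φ.hom '' C.gluingSet (HGraph.coupledClass o e) =
      C'.gluingSet (ε '' HGraph.coupledClass o e) := by
  -- Corresponding points are attached to coupled edges.
  have key : ∀ (q : C.dualGraph.H) (f : C.dualGraph.E) (q' : C'.dualGraph.H), φ.hom q.1 = q'.1 →
      ε f = C'.dualGraph.edge q' → HGraph.Coupled o (C.dualGraph.edge q) f := by
    intro q f q' hqq hf c hc
    have h1 := hsupp c hc (C.halfPoint q)
    have h2 : closedPointsEquiv φ (C.halfPoint q) = C'.halfPoint q' := Subtype.ext hqq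
    rw [h2, etaTilde_halfPoint_ne_zero_iff, etaTilde_halfPoint_ne_zero_iff, ← hf,
      HGraph.chainEquiv_apply] at h1
    exact not_iff_not.1 h1
  ext y
  refine Iff.trans ?_ mem_gluingSet.symm
  constructor
  · rintro ⟨x, hxS, rfl⟩
    obtain ⟨h, hxe⟩ := mem_gluingSet.1 hxS
    obtain ⟨c, hc, hce⟩ := HGraph.exists_mem_H1_of_not_isSeparating o
      (hbr (C.dualGraph.edge (halfEdge h)))
    have h1 := (hsupp c hc _).1 ((etaTilde_halfPoint_ne_zero_iff o c (halfEdge h)).2 hce)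
    have h2 : C'.ν.left (φ.hom x) ∈ C'.nodes := by
      by_contra hn
      exact h1 (etaTilde_apply_of_notMem o' _ hn)
    obtain ⟨f, hf⟩ := ε.surjective (C'.dualGraph.edge (halfEdge h2))
    exact ⟨h2, f, HGraph.Coupled.trans hxe (key (halfEdge h) f (halfEdge h2) rfl hf), hf⟩
  · rintro ⟨h, f, hf, hfy⟩
    obtain ⟨c, hc, hce⟩ := HGraph.exists_mem_H1_of_not_isSeparating o (hbr f)
    obtain ⟨x, hxy⟩ := (closedPointsEquiv φ).surjective (C'.halfPoint (halfEdge h))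
    have h1 := (etaTilde_halfPoint_ne_zero_iff o' (HGraph.chainEquiv ε c) (halfEdge h)).2
      (by rw [← hfy, HGraph.chainEquiv_apply]; exact hce)
    rw [← hxy] at h1
    have h2 : C.ν.left x.1 ∈ C.nodes := by
      by_contra hn
      exact (hsupp c hc x).2 h1 (etaTilde_apply_of_notMem o c hn)
    have hφ : φ.hom x.1 = y := congrArg Subtype.val hxy
    exact ⟨x.1, mem_gluingSet.2 ⟨h2, HGraph.Coupled.trans hf
      (key (halfEdge h2) f (halfEdge h) hφ hfy).symm⟩, hφ⟩

theorem TEquivalent.c1Equivalent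
    (hconn : C.dualGraph.IsConnected) (hbr : ∀ e, ¬ C.dualGraph.IsSeparating e)
    (hconn' : C'.dualGraph.IsConnected) (hbr' : ∀ e, ¬ C'.dualGraph.IsSeparating e)
    (h : C.TEquivalent C') : C.C1Equivalent C' := by
  obtain ⟨φ, ε, -, hT⟩ := h
  let o := Classical.arbitrary C.dualGraph.Orientation
  obtain ⟨o', hH, α, hη⟩ := hT o
  refine ⟨φ, (Equiv.Set.congr ε).subtypeEquiv
    fun S => HGraph.isC1Set_image_iff hconn hbr hconn' hbr' hH S, ?_⟩
  rintro ⟨S, hS⟩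
  obtain ⟨e, rfl⟩ := (HGraph.isC1Set_iff_eq_coupledClass hconn hbr o S).1 hS
  refine image_gluingSet_coupledClass ((Over.forget _).mapIso φ) (o' := o') hbr (fun c hc x => ?_) e
  have := (divMap0_eta_eq_iff _ o o' α ⟨c, hc⟩ _).1 (hη ⟨c, hc⟩) x
  rw [this]
  simp

/-! ### From C1-equivalence to T-equivalence -/

/-- The bijection of connected components given by a homeomorphism. -/
def connectedComponentsEquiv {X Y : Type*} [TopologicalSpace X] [TopologicalSpace Y] (f : X ≃ₜ Y) :
    ConnectedComponents X ≃ ConnectedComponents Y where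
  toFun := f.continuous.connectedComponentsMap
  invFun := f.symm.continuous.connectedComponentsMap
  left_inv c := by
    obtain ⟨x, rfl⟩ := ConnectedComponents.surjective_coe c
    exact congrArg ConnectedComponents.mk (f.symm_apply_apply x)
  right_inv c := by
    obtain ⟨x, rfl⟩ := ConnectedComponents.surjective_coe c
    exact congrArg ConnectedComponents.mk (f.apply_symm_apply x)

/-- The dual graphs of C1-equivalent curves are regluings of each other: every node lies in a
C1-set, hence the isomorphism of the normalizations preserves the gluing points. -/
lemma exists_regluing (hconn : C.dualGraph.IsConnected) (hbr : ∀ e, ¬ C.dualGraph.IsSeparating e)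
    (hconn' : C'.dualGraph.IsConnected) (hbr' : ∀ e, ¬ C'.dualGraph.IsSeparating e)
    (φ : C.N.left ≅ C'.N.left)
    (β : {S : Set C.dualGraph.E // C.dualGraph.IsC1Set S} ≃
      {S' : Set C'.dualGraph.E // C'.dualGraph.IsC1Set S'})
    (hβ : ∀ S, φ.hom '' C.gluingSet S.1 = C'.gluingSet (β S).1) :
    ∃ ρ : HGraph.Regluing C.dualGraph C'.dualGraph,
      ∀ q, (ρ.half q).1 = φ.hom q.1 := by
  have hinj : Function.Injective φ.hom := (Scheme.homeoOfIso φ).injective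
  have hmem : ∀ S q, φ.hom q ∈ C'.gluingSet (β S).1 ↔ q ∈ C.gluingSet S.1 := by
    intro S q
    rw [← hβ, hinj.mem_set_image]
  have hnodes : ∀ q, C.ν.left q ∈ C.nodes ↔ C'.ν.left (φ.hom q) ∈ C'.nodes := by
    intro q
    constructor
    · intro h
      let S : {S : Set C.dualGraph.E // C.dualGraph.IsC1Set S} :=
        ⟨_, HGraph.isC1Set_coupledClass hconn hbr (Classical.arbitrary _)
          (C.dualGraph.edge (halfEdge h))⟩
      exact ((hmem S q).2 ⟨h, HGraph.Coupled.refl _ _⟩).1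
    · intro h
      let S : {S : Set C'.dualGraph.E // C'.dualGraph.IsC1Set S} :=
        ⟨_, HGraph.isC1Set_coupledClass hconn' hbr' (Classical.arbitrary _)
          (C'.dualGraph.edge (halfEdge h))⟩
      have h1 := hmem (β.symm S) q
      rw [β.apply_symm_apply] at h1
      exact (h1.1 ⟨h, HGraph.Coupled.refl _ _⟩).1
  exact ⟨{
    half := (Scheme.homeoOfIso φ).toEquiv.subtypeEquiv hnodes
    vertex := connectedComponentsEquiv (Scheme.homeoOfIso φ)
    vert_half := fun _ => rfl
    c1 := β
    edge_half := fun S q =>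
      ⟨fun h => ((hmem S q.1).1 ⟨(hnodes q.1).1 q.2, h⟩).2, fun h => ((hmem S q.1).2 ⟨q.2, h⟩).2⟩ },
    fun _ => rfl⟩

theorem C1Equivalent.tEquivalent
    (hconn : C.dualGraph.IsConnected) (hbr : ∀ e, ¬ C.dualGraph.IsSeparating e)
    (hconn' : C'.dualGraph.IsConnected) (hbr' : ∀ e, ¬ C'.dualGraph.IsSeparating e)
    (h : C.C1Equivalent C') : C.TEquivalent C' := by
  obtain ⟨φ, β, hβ⟩ := h
  let φ' : C.N.left ≅ C'.N.left := (Over.forget _).mapIso φ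
  obtain ⟨ρ, hρ⟩ := exists_regluing hconn hbr hconn' hbr' φ' β hβ
  obtain ⟨ε, hε⟩ := ρ.exists_edge_equiv hconn hbr hconn' hbr'
  have hT := ρ.exists_orientation_signs hconn hbr hconn' hbr' hε
  obtain ⟨o₀', -, hH₀, -⟩ := hT (Classical.arbitrary _)
  refine ⟨φ, ε, HGraph.isCyclicBijection_of_H1 hH₀, fun o => ?_⟩
  obtain ⟨o', α, hH, hflow⟩ := hT o
  refine ⟨o', hH, α, fun c => ?_⟩
  refine (divMap0_eta_eq_iff φ' o o' α c _).2 fun x => ?_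
  by_cases hx : C.ν.left x.1 ∈ C.nodes
  · have h1 : closedPointsEquiv φ' x = C'.halfPoint (ρ.half (halfEdge hx)) :=
      Subtype.ext (hρ (halfEdge hx)).symm
    rw [h1, etaTilde_halfPoint]
    refine (hflow c.1 c.2 (halfEdge hx)).trans ?_
    rw [← etaTilde_halfPoint]
    rfl
  · rw [etaTilde_apply_of_notMem o c.1 hx, etaTilde_apply_of_notMem, mul_zero]
    intro hx'
    obtain ⟨q, hq⟩ := ρ.half.surjective ⟨(closedPointsEquiv φ' x).1, hx'⟩
    have h1 : φ'.hom q.1 = φ'.hom x.1 := by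
      rw [← hρ, hq]; rfl
    have h2 : q.1 = x.1 := (Scheme.homeoOfIso φ').injective h1
    exact hx (h2 ▸ q.2)

end NodalCurve

end

theorem mainTheorem6 {k : Type u} [Field k] [IsAlgClosed k] (C C' : NodalCurve k)
    [ConnectedSpace C.X.left] [ConnectedSpace C'.X.left]
    (hsep : ∀ p, ¬ C.IsSeparatingNode p) (hsep' : ∀ p, ¬ C'.IsSeparatingNode p) :
    C.TEquivalent C' ↔ C.C1Equivalent C' := by
  have hbr : ∀ e, ¬ C.dualGraph.IsSeparating e :=
    fun e he => hsep e.1 (C.isSeparatingNode_of_isSeparating he)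
  have hbr' : ∀ e, ¬ C'.dualGraph.IsSeparating e :=
    fun e he => hsep' e.1 (C'.isSeparatingNode_of_isSeparating he)
  exact ⟨NodalCurve.TEquivalent.c1Equivalent C.isConnected_dualGraph hbr
      C'.isConnected_dualGraph hbr',
    NodalCurve.C1Equivalent.tEquivalent C.isConnected_dualGraph hbr C'.isConnected_dualGraph hbr'⟩
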